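/- **Definitions.** A *net* $N=(S,T,F,M_0)$ consists of disjoint sets $S$ (places) and $T$ (transitions), a flow relation with arc weights $F:(S\times T)\cup(T\times S)\to\mathbb N$ and an initial marking $M_0:S\to\mathbb N$, such that for every $t\in T$ the set $\{s\mid F(s,t)>0\}$ is finite and non-empty and $\{s\mid F(t,s)>0\}$ is finite. It is *countable* if $S$ and $T$ are countable. Write ${}^\bullet x(y)=F(y,x)$, $x^\bullet(y)=F(x,y)$, extended additively to finite multisets of transitions. A finite non-empty multiset $G$ of transitions is a *step* from $M$ to $M'$ (markings in $\mathbb N^S$) if ${}^\bullet G\le M$ and $M'=(M-{}^\bullet G)+G^\bullet$; $G$ *can fire* in $M$ if it is a step from $M$ to some $M'$. A marking is *reachable* if it is obtained from $M_0$ by firing a finite sequence of single transitions. $N$ is *binary-conflict-free* if there are no reachable marking $M$ and multiset $G\in\mathbb N^T$ with $|G|=2$ such that for every $t\in G$ the restriction of $G$ to $\{t\}$ can fire in $M$, but $G$ cannot fire in $M$. A *(GR-)process* of $N$ is a pair $P=(\mathcal N,\pi)$ where $\mathcal N=(\mathcal S,\mathcal T,\mathcal F,\mathcal M_0)$ is a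 net such that $|{}^\bullet s|\le 1$ and $|s^\bullet|\le 1$ for every $s\in\mathcal S$; $\mathcal M_0(s)=1$ if ${}^\bullet s=\emptyset$ and $\mathcal M_0(s)=0$ otherwise; the transitive closure $\mathcal F^+$ of $\{(x,y)\mid \mathcal F(x,y)>0\}$ is irreflexive; and $\{t\in\mathcal T\mid (t,u)\in\mathcal F^+\}$ is finite for all $u\in\mathcal T$; and $\pi:\mathcal S\cup\mathcal T\to S\cup T$ maps places to places and transitions to transitions, with $M_0(s)=|\pi^{-1}(s)\cap\mathcal M_0|$, $F(s,\pi(t))=|\pi^{-1}(s)\cap{}^\bullet t|$ and $F(\pi(t),s)=|\pi^{-1}(s)\cap t^\bullet|$ for all $t\in\mathcal T$, $s\in S$. It is *finite* if $\mathcal T$ is finite. A process $P'=((\mathcal S',\mathcal T',\mathcal F',\mathcal M_0'),\pi')$ is a *prefix* of $P$, written $P'\le P$, if $\mathcal S'\subseteq\mathcal S$, $\mathcal T'\subseteq\mathcal T$, $\mathcal M_0'=\mathcal M_0$ (as multisets), and $\mathcal F'$, $\pi'$ are the restrictions of $\mathcal F$, $\pi$. (Processes may be renamed isomorphically here; this does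 not affect the notions below.) Write $P\approx_s Q$ if there are places $p,q$ of $P$ with $\pi(p)=\pi(q)$, $(p,q)\notin\mathcal F^+$, $(q,p)\notin\mathcal F^+$, such that exchanging the outgoing arcs of $p$ and $q$ in $P$ gives a pair isomorphic to $Q$, by an isomorphism of nets compatible with the maps to $N$. Let $\approx_s^*$ be the reflexive and transitive closure of $\approx_s$, and for finite $P$ let $[P]$ be its $\approx_s^*$-class. Put $[P']\le[P]$ if $P'\approx_s^* Q'\le Q\approx_s^* P$ for some $Q',Q$. For an arbitrary process $P$ let $BD(P)$ be the set of those classes $[R]$ of finite processes $R$ with $[R]\le[P']$ for some finite $P'\le P$. Processes $P,Q$ are *swapping equivalent*, $P\approx_s^\infty Q$, if $BD(P)=BD(Q)$. A *BD-process* of $N$ is an $\approx_s^\infty$-class $[P]_\infty$ of processes of $N$. Put $[P]_\infty\preceq[Q]_\infty$ if $P'\le Q'$ for some $P'\approx_s^\infty P$ and $Q'\approx_s^\infty Q$, and let $\le$ on BD-processes be the transitive closure of $\preceq$; it is a partial order. A BD-process is *maximal* if it is maximal for $\le$; equivalently, $[P]_\infty$ is maximal iff $P'\le Q$ implies $P'\approx_s^\infty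 Q$ for all $P'\in[P]_\infty$ and all processes $Q$ of $N$. **Theorem.** Every countable binary-conflict-free net has exactly one maximal BD-process. -/

import Mathlib

universe u

namespace PetriNet

/-! ### Nets and their firing rule -/

/-- A net (place/transition system with arc weights and an initial marking).  Places and
transitions live in two different types, hence are disjoint.  The flow relation `F` is given by
its two halves `inArc s t = F(s, t)` and `outArc t s = F(t, s)`.  Every transition has finitely
many and at least one preplace, and finitely many postplaces. -/
structure Net where
  /-- places -/
  S : Type u
  /-- transitions -/
  T : Type u
  /-- arc weights from places to transitions -/
  inArc : S → T → ℕ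
  /-- arc weights from transitions to places -/
  outArc : T → S → ℕ
  /-- initial marking -/
  M₀ : S → ℕ
  pre_finite : ∀ t, {s | 0 < inArc s t}.Finite
  pre_nonempty : ∀ t, {s | 0 < inArc s t}.Nonempty
  post_finite : ∀ t, {s | 0 < outArc t s}.Finite

namespace Net

variable (N : Net.{u})

/-- The flow relation as a function on all pairs of elements (places or transitions). -/
def flow : N.S ⊕ N.T → N.S ⊕ N.T → ℕ
  | .inl s, .inr t => N.inArc s t
  | .inr t, .inl s => N.outArc t s
  | _, _ => 0

/-- The transitive closure `F⁺` of the flow relation. -/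
def FPlus : N.S ⊕ N.T → N.S ⊕ N.T → Prop :=
  Relation.TransGen fun x y => 0 < N.flow x y

/-- The preset of a finite multiset of transitions, a multiset of places. -/
def preSet (G : N.T →₀ ℕ) : N.S → ℕ := fun s => G.sum fun t n => n * N.inArc s t

/-- The postset of a finite multiset of transitions, a multiset of places. -/
def postSet (G : N.T →₀ ℕ) : N.S → ℕ := fun s => G.sum fun t n => n * N.outArc t s

/-- `G` is a step from marking `M` to marking `M'`. -/
def Step (M : N.S → ℕ) (G : N.T →₀ ℕ) (M' : N.S → ℕ) : Prop :=
  G ≠ 0 ∧ N.preSet G ≤ M ∧ M' = M - N.preSet G + N.postSet G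

/-- Firing a word of transitions one by one. -/
def Fires : (N.S → ℕ) → List N.T → (N.S → ℕ) → Prop
  | M, [], M' => M = M'
  | M, t :: σ, M' => ∃ M₁, N.Step M (Finsupp.single t 1) M₁ ∧ Fires M₁ σ M'

/-- `M` is reachable from the initial marking. -/
def Reachable (M : N.S → ℕ) : Prop := ∃ σ, N.Fires N.M₀ σ M

/-- The multiset `G` of transitions can fire in `M`. -/
def CanFire (M : N.S → ℕ) (G : N.T →₀ ℕ) : Prop := ∃ M', N.Step M G M'

/-- The finite multiset `G` is in semantic conflict in `M`: for each `t ∈ G` the restriction of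
`G` to `{t}` can fire in `M`, but `G` cannot. -/
def InConflict (M : N.S → ℕ) (G : N.T →₀ ℕ) : Prop :=
  (∀ t, 0 < G t → N.CanFire M (Finsupp.single t (G t))) ∧ ¬ N.CanFire M G

/-- No multiset of exactly two transitions is in conflict in a reachable marking. -/
def BinaryConflictFree : Prop :=
  ∀ M, N.Reachable M → ∀ G : N.T →₀ ℕ, G.degree = 2 → ¬ N.InConflict M G

end Net

/-! ### Processes -/

/-- A net together with a map to `N` sending places to places and transitions to transitions. -/
structure MappedNet (N : Net.{u}) where
  net : Net.{u}
  mapS : net.S → N.S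
  mapT : net.T → N.T

/-- The pair `P` is a (GR-)process of `N`.  The first two conditions say `|•s| ≤ 1`, the next two
`|s•| ≤ 1`.  By these, presets and postsets of transitions are sets, and so is the
initial marking. -/
structure IsProcess {N : Net.{u}} (P : MappedNet N) : Prop where
  outArc_le_one : ∀ t s, P.net.outArc t s ≤ 1
  outArc_unique : ∀ s t t', 0 < P.net.outArc t s → 0 < P.net.outArc t' s → t = t'
  inArc_le_one : ∀ s t, P.net.inArc s t ≤ 1
  inArc_unique : ∀ s t t', 0 < P.net.inArc s t → 0 < P.net.inArc s t' → t = t'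
  init_of_pre_empty : ∀ s, (∀ t, P.net.outArc t s = 0) → P.net.M₀ s = 1
  init_of_pre_nonempty : ∀ s, (∃ t, 0 < P.net.outArc t s) → P.net.M₀ s = 0
  acyclic : ∀ x, ¬ P.net.FPlus x x
  finite_past : ∀ u, {t | P.net.FPlus (.inr t) (.inr u)}.Finite
  map_init : ∀ s, (N.M₀ s : ℕ∞) = {x | P.mapS x = s ∧ 0 < P.net.M₀ x}.encard
  map_pre : ∀ t s, (N.inArc s (P.mapT t) : ℕ∞) =
    {x | P.mapS x = s ∧ 0 < P.net.inArc x t}.encard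
  map_post : ∀ t s, (N.outArc (P.mapT t) s : ℕ∞) =
    {x | P.mapS x = s ∧ 0 < P.net.outArc t x}.encard

/-- The type of (GR-)processes of `N`. -/
def GRProcess (N : Net.{u}) := {P : MappedNet N // IsProcess P}

/-- Isomorphism of nets that respects the maps to `N`. -/
def MappedNet.Iso {N : Net.{u}} (P Q : MappedNet N) : Prop :=
  ∃ (f : P.net.S ≃ Q.net.S) (g : P.net.T ≃ Q.net.T),
    (∀ s, Q.net.M₀ (f s) = P.net.M₀ s) ∧
    (∀ s t, Q.net.inArc (f s) (g t) = P.net.inArc s t) ∧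
    (∀ t s, Q.net.outArc (g t) (f s) = P.net.outArc t s) ∧
    (∀ s, P.mapS s = Q.mapS (f s)) ∧
    (∀ t, P.mapT t = Q.mapT (g t))

open Classical in
/-- Exchange the outgoing arcs of the places `p` and `q`. -/
noncomputable def MappedNet.swap {N : Net.{u}} (P : MappedNet N) (p q : P.net.S) :
    MappedNet N where
  net :=
    { S := P.net.S
      T := P.net.T
      inArc := fun x t =>
        if x = p then P.net.inArc q t else if x = q then P.net.inArc p t else P.net.inArc x t
      outArc := P.net.outArc
      M₀ := P.net.M₀
      pre_finite := fun t => by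
        refine ((P.net.pre_finite t).union ((Set.finite_singleton p).union
          (Set.finite_singleton q))).subset ?_
        intro x hx
        by_cases h1 : x = p
        · exact Or.inr (Or.inl h1)
        · by_cases h2 : x = q
          · exact Or.inr (Or.inr h2)
          · left
            simpa [h1, h2] using hx
      pre_nonempty := fun t => by
        obtain ⟨x, hx⟩ := P.net.pre_nonempty t
        change 0 < P.net.inArc x t at hx
        by_cases h1 : x = p
        · subst h1
          by_cases h2 : q = x
          · exact ⟨x, by simpa [h2] using hx⟩
          · exact ⟨q, by simpa [h2] using hx⟩
        · by_cases h2 : x = q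
          · subst h2
            exact ⟨p, by simpa using hx⟩
          · exact ⟨x, by simpa [h1, h2] using hx⟩
      post_finite := P.net.post_finite }
  mapS := P.mapS
  mapT := P.mapT

namespace GRProcess

variable {N : Net.{u}}

/-- A process is finite if it has finitely many transitions. -/
def IsFinite (P : GRProcess N) : Prop := Finite P.1.net.T

/-- The prefix relation between processes, stated for processes over arbitrary types: `P'` is,
up to the injective renaming `f`, `g`, a subnet of `P` with the same initial marking as `P` and
with the flow relation and the map to `N` restricted from `P`. -/
def IsPrefix (P' P : GRProcess N) : Prop :=
  ∃ (f : P'.1.net.S → P.1.net.S) (g : P'.1.net.T → P.1.net.T),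
    Function.Injective f ∧ Function.Injective g ∧
    (∀ s, P'.1.net.M₀ s = P.1.net.M₀ (f s)) ∧
    (∀ x, 0 < P.1.net.M₀ x → x ∈ Set.range f) ∧
    (∀ s t, P'.1.net.inArc s t = P.1.net.inArc (f s) (g t)) ∧
    (∀ t s, P'.1.net.outArc t s = P.1.net.outArc (g t) (f s)) ∧
    (∀ s, P'.1.mapS s = P.1.mapS (f s)) ∧
    (∀ t, P'.1.mapT t = P.1.mapT (g t))

theorem IsPrefix.refl (P : GRProcess N) : P.IsPrefix P :=
  ⟨id, id, Function.injective_id, Function.injective_id, fun _ => rfl, fun x _ => ⟨x, rfl⟩,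
    fun _ _ => rfl, fun _ _ => rfl, fun _ => rfl, fun _ => rfl⟩

theorem IsPrefix.trans {P Q R : GRProcess N} (h : P.IsPrefix Q) (h' : Q.IsPrefix R) :
    P.IsPrefix R := by
  obtain ⟨f, g, hf, hg, h1, h2, h3, h4, h5, h6⟩ := h
  obtain ⟨f', g', hf', hg', h1', h2', h3', h4', h5', h6'⟩ := h'
  refine ⟨f' ∘ f, g' ∘ g, hf'.comp hf, hg'.comp hg, fun s => (h1 s).trans (h1' _), ?_,
    fun s t => (h3 s t).trans (h3' _ _), fun t s => (h4 t s).trans (h4' _ _),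
    fun s => (h5 s).trans (h5' _), fun t => (h6 t).trans (h6' _)⟩
  intro x hx
  obtain ⟨y, rfl⟩ := h2' x hx
  obtain ⟨z, rfl⟩ := h2 y (by rw [h1' y]; exact hx)
  exact ⟨z, rfl⟩

/-- One step swapping equivalence: exchanging the outgoing arcs of two causally unrelated places
`p`, `q` with the same image in `N` turns `P` into an isomorphic copy of `Q`. -/
def OneStepSwap (P Q : GRProcess N) : Prop :=
  ∃ p q : P.1.net.S,
    ¬ P.1.net.FPlus (.inl p) (.inl q) ∧ ¬ P.1.net.FPlus (.inl q) (.inl p) ∧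
    P.1.mapS p = P.1.mapS q ∧ (P.1.swap p q).Iso Q.1

/-- The reflexive and transitive closure of one step swapping equivalence. -/
def SwapStar : GRProcess N → GRProcess N → Prop := Relation.ReflTransGen OneStepSwap

/-- The class of `P` under `SwapStar`. -/
def finClass (P : GRProcess N) : Set (GRProcess N) := {Q | P.SwapStar Q}

/-- The prefix relation lifted to classes under `SwapStar`. -/
def ClassLE (A B : Set (GRProcess N)) : Prop := ∃ Q' ∈ A, ∃ Q ∈ B, Q'.IsPrefix Q

/-- Prefix-closure of a set of classes, within the classes of finite processes. -/
def prefixClosure (X : Set (Set (GRProcess N))) : Set (Set (GRProcess N)) :=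
  {A | (∃ P : GRProcess N, P.IsFinite ∧ A = P.finClass) ∧ ∃ B ∈ X, ClassLE A B}

/-- The set of all finite approximations of `P`: the prefix-closure of the set of classes of
finite prefixes of `P`. -/
def bd (P : GRProcess N) : Set (Set (GRProcess N)) :=
  prefixClosure {A | ∃ P' : GRProcess N, P'.IsPrefix P ∧ P'.IsFinite ∧ A = P'.finClass}

/-- Swapping equivalence of possibly infinite processes. -/
def swapSetoid (N : Net.{u}) : Setoid (GRProcess N) := Setoid.ker (bd (N := N))

theorem bd_mono {P Q : GRProcess N} (h : P.IsPrefix Q) : P.bd ⊆ Q.bd := by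
  rintro A ⟨hA, B, ⟨P', hP', hfin, rfl⟩, hAB⟩
  exact ⟨hA, _, ⟨P', hP'.trans h, hfin, rfl⟩, hAB⟩

end GRProcess

/-- A BD-process is a class of processes under swapping equivalence. -/
def BDProcess (N : Net.{u}) := Quotient (GRProcess.swapSetoid N)

namespace BDProcess

variable {N : Net.{u}}

/-- The class of a process under swapping equivalence. -/
def mk (P : GRProcess N) : BDProcess N := Quotient.mk (GRProcess.swapSetoid N) P

theorem mk_eq_mk {P Q : GRProcess N} : mk P = mk Q ↔ P.bd = Q.bd :=
  Quotient.eq (r := GRProcess.swapSetoid N)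

/-- Some member of the first class is a prefix of some member of the second. -/
def Preceq (A B : BDProcess N) : Prop :=
  ∃ P' Q' : GRProcess N, mk P' = A ∧ mk Q' = B ∧ P'.IsPrefix Q'

theorem bd_subset_of_transGen {A B : BDProcess N} (h : Relation.TransGen Preceq A B) :
    ∀ P Q : GRProcess N, mk P = A → mk Q = B → P.bd ⊆ Q.bd := by
  have key : ∀ {A B : BDProcess N}, Preceq A B → ∀ P Q : GRProcess N, mk P = A → mk Q = B →
      P.bd ⊆ Q.bd := by
    rintro A B ⟨P', Q', rfl, rfl, hpq⟩ P Q hP hQ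
    rw [mk_eq_mk.1 hP, mk_eq_mk.1 hQ]
    exact GRProcess.bd_mono hpq
  induction h with
  | single h => exact key h
  | @tail B C _ hBC ih =>
    intro P Q hP hQ
    obtain ⟨R, rfl⟩ := Quotient.exists_rep B
    exact (ih P R hP rfl).trans (key hBC R Q rfl hQ)

/-- The order on BD-processes: the transitive closure of `Preceq`. -/
instance instPartialOrder : PartialOrder (BDProcess N) where
  le := Relation.TransGen Preceq
  le_refl A := by
    obtain ⟨P, rfl⟩ := Quotient.exists_rep A
    exact Relation.TransGen.single ⟨P, P, rfl, rfl, GRProcess.IsPrefix.refl P⟩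
  le_trans _ _ _ h h' := Relation.TransGen.trans h h'
  le_antisymm A B h h' := by
    obtain ⟨P, rfl⟩ := Quotient.exists_rep A
    obtain ⟨Q, rfl⟩ := Quotient.exists_rep B
    exact mk_eq_mk.2 ((bd_subset_of_transGen h P Q rfl rfl).antisymm
      (bd_subset_of_transGen h' Q P rfl rfl))

/-- Maximality in the order means: no member of the class has an extension outside of it. -/
theorem isMax_iff {A : BDProcess N} :
    IsMax A ↔ ∀ P' : GRProcess N, mk P' = A → ∀ Q : GRProcess N, P'.IsPrefix Q → mk P' = mk Q := by
  constructor
  · rintro h P' rfl Q hQ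
    exact h.eq_of_le (Relation.TransGen.single ⟨P', Q, rfl, rfl, hQ⟩)
  · intro h B hB
    have hB' : Relation.TransGen Preceq A B := hB
    have : A = B := by
      clear hB
      induction hB' with
      | single hAB =>
        obtain ⟨P', Q', rfl, rfl, hpq⟩ := hAB
        exact h P' rfl Q' hpq
      | tail _ hBC ih =>
        subst ih
        obtain ⟨P', Q', rfl, rfl, hpq⟩ := hBC
        exact h P' rfl Q' hpq
    exact this ▸ le_refl _

end BDProcess

end PetriNet

/-! The maximal BD-process turns out to be the one whose set of finite approximations consists of
the classes of all finite processes. Since the order refines inclusion of `bd`, such a process is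
maximal. It remains to build one and to show that every maximal process is of this kind.

Labels instead of nets. When the net has countably many places, every process can be numbered along
its causal order. It then becomes a run: a labelling of event numbers by transitions, together with
a function saying which event consumes which token. The consumption function is irrelevant up to
swapping. Two runs with the same labelling and finitely many disagreements are related by finitely
many swaps (`runProc_swapStar`), and two arbitrary runs with the same labelling have the same `bd`
(`bd_runProc_congr`). A labelling carries a run if and only if its events can fire in succession
(`Firable.exists_run`, `IsRun.firable`).

Conflict freeness. Suppose `v` is enabled before event `k` and no later event is labelled `v`. Every
later event `t` is then compatible with `v`, so `v` can be fired at `k` and its products left unused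
while all later events still fire (`Firable.insert`). If `v` does occur later, first at `i`, insert
it at `k` into the part before `i`. As nothing depends on it, it can be postponed to `i`, which
gives back the old labelling (`IsRun.exists_postponed`). So if a finite run without its last event
approximates `P`, then, up to swapping equivalence, `P` extends to a process approximated by the
whole run (`exists_extension_approx`).

Uniqueness follows by induction on the length of a finite run, because a maximal process has no
proper extension (`approx_of_isMax`). For existence, the countably many finite labellings are
enumerated, and a growing sequence of finite runs absorbs them one after the other; the limit
labelling is firable and approximated by everything (`exists_largest`). -/

namespace PetriNet

open Relation

/-! ### Prefix embeddings -/

namespace GRProcess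

variable {N : Net.{u}}

/-- An embedding of a process onto a prefix of another one. -/
structure PrefixMap (P' P : GRProcess N) where
  f : P'.1.net.S → P.1.net.S
  g : P'.1.net.T → P.1.net.T
  f_inj : Function.Injective f
  g_inj : Function.Injective g
  init : ∀ s, P'.1.net.M₀ s = P.1.net.M₀ (f s)
  init_mem : ∀ x, 0 < P.1.net.M₀ x → x ∈ Set.range f
  inArc : ∀ s t, P'.1.net.inArc s t = P.1.net.inArc (f s) (g t)
  outArc : ∀ t s, P'.1.net.outArc t s = P.1.net.outArc (g t) (f s)
  mapS : ∀ s, P'.1.mapS s = P.1.mapS (f s)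
  mapT : ∀ t, P'.1.mapT t = P.1.mapT (g t)

theorem PrefixMap.isPrefix {P' P : GRProcess N} (φ : PrefixMap P' P) : P'.IsPrefix P :=
  ⟨φ.f, φ.g, φ.f_inj, φ.g_inj, φ.init, φ.init_mem, φ.inArc, φ.outArc, φ.mapS, φ.mapT⟩

theorem IsPrefix.exists_map {P' P : GRProcess N} (h : P'.IsPrefix P) :
    Nonempty (PrefixMap P' P) := by
  obtain ⟨f, g, h1, h2, h3, h4, h5, h6, h7, h8⟩ := h
  exact ⟨⟨f, g, h1, h2, h3, h4, h5, h6, h7, h8⟩⟩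

/-- A place is initially marked or has a producer. -/
theorem init_or_producer (P : GRProcess N) (x : P.1.net.S) :
    P.1.net.M₀ x = 1 ∨ ∃ t, 0 < P.1.net.outArc t x := by
  by_cases h : ∃ t, 0 < P.1.net.outArc t x
  · exact Or.inr h
  · left
    push Not at h
    exact P.2.init_of_pre_empty x fun t => by simpa using h t

namespace PrefixMap

variable {P' P : GRProcess N} (φ : PrefixMap P' P)

/-- On each place of `N`, the preplaces of `t` and of its image are both counted by the same finite
number, an arc weight of `N`. The embedding therefore cannot miss any. -/
theorem pre_mem {x t} (h : 0 < P.1.net.inArc x (φ.g t)) : x ∈ Set.range φ.f := by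
  have hA := P'.2.map_pre t (P.1.mapS x)
  have hB := P.2.map_pre (φ.g t) (P.1.mapS x)
  rw [φ.mapT t] at hA
  set A := {y | P'.1.mapS y = P.1.mapS x ∧ 0 < P'.1.net.inArc y t}
  set B := {y | P.1.mapS y = P.1.mapS x ∧ 0 < P.1.net.inArc y (φ.g t)}
  have hsub : φ.f '' A ⊆ B := by
    rintro _ ⟨y, ⟨hy1, hy2⟩, rfl⟩
    exact ⟨by rw [← φ.mapS, hy1], by rw [← φ.inArc]; exact hy2⟩
  have hfin : B.Finite := Set.finite_of_encard_eq_coe hB.symm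
  have heq : φ.f '' A = B := by
    refine (hfin.subset hsub).eq_of_subset_of_encard_le hsub ?_
    rw [φ.f_inj.encard_image, ← hA, ← hB]
  have hx : x ∈ B := ⟨rfl, h⟩
  rw [← heq] at hx
  obtain ⟨y, -, rfl⟩ := hx
  exact ⟨y, rfl⟩

theorem post_mem {x t} (h : 0 < P.1.net.outArc (φ.g t) x) : x ∈ Set.range φ.f := by
  have hA := P'.2.map_post t (P.1.mapS x)
  have hB := P.2.map_post (φ.g t) (P.1.mapS x)
  rw [φ.mapT t] at hA
  set A := {y | P'.1.mapS y = P.1.mapS x ∧ 0 < P'.1.net.outArc t y}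
  set B := {y | P.1.mapS y = P.1.mapS x ∧ 0 < P.1.net.outArc (φ.g t) y}
  have hsub : φ.f '' A ⊆ B := by
    rintro _ ⟨y, ⟨hy1, hy2⟩, rfl⟩
    exact ⟨by rw [← φ.mapS, hy1], by rw [← φ.outArc]; exact hy2⟩
  have hfin : B.Finite := Set.finite_of_encard_eq_coe hB.symm
  have heq : φ.f '' A = B := by
    refine (hfin.subset hsub).eq_of_subset_of_encard_le hsub ?_
    rw [φ.f_inj.encard_image, ← hA, ← hB]
  have hx : x ∈ B := ⟨rfl, h⟩
  rw [← heq] at hx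
  obtain ⟨y, -, rfl⟩ := hx
  exact ⟨y, rfl⟩

theorem producer_mem {x t} (h : 0 < P.1.net.outArc t (φ.f x)) : t ∈ Set.range φ.g := by
  rcases P'.init_or_producer x with h0 | ⟨t', ht'⟩
  · have := P.2.init_of_pre_nonempty _ ⟨t, h⟩
    rw [← φ.init, h0] at this
    exact absurd this one_ne_zero
  · rw [φ.outArc] at ht'
    exact ⟨t', P.2.outArc_unique _ _ _ ht' h⟩

theorem flow_pos {x : P.1.net.S ⊕ P.1.net.T} {y : P'.1.net.S ⊕ P'.1.net.T}
    (h : 0 < P.1.net.flow x (Sum.map φ.f φ.g y)) :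
    ∃ x', x = Sum.map φ.f φ.g x' ∧ 0 < P'.1.net.flow x' y := by
  rcases x with x | x <;> rcases y with y | y <;> simp only [Sum.map_inl, Sum.map_inr, Net.flow,
    lt_irrefl] at h
  · obtain ⟨x', rfl⟩ := φ.pre_mem h
    exact ⟨.inl x', rfl, by simpa [Net.flow, φ.inArc] using h⟩
  · obtain ⟨x', rfl⟩ := φ.producer_mem h
    exact ⟨.inr x', rfl, by simpa [Net.flow, φ.outArc] using h⟩

/-- Prefixes are closed under causal predecessors: each single arc into the image starts in the
image, by `pre_mem` and `producer_mem`. -/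
theorem fplus_reflect {x : P.1.net.S ⊕ P.1.net.T} {y : P'.1.net.S ⊕ P'.1.net.T}
    (h : P.1.net.FPlus x (Sum.map φ.f φ.g y)) :
    ∃ x', x = Sum.map φ.f φ.g x' ∧ P'.1.net.FPlus x' y := by
  unfold Net.FPlus at h
  induction h using TransGen.head_induction_on with
  | single h =>
    obtain ⟨x', rfl, hx'⟩ := φ.flow_pos h
    exact ⟨x', rfl, TransGen.single hx'⟩
  | head h _ ih =>
    obtain ⟨z, rfl, hz⟩ := ih
    obtain ⟨x', rfl, hx'⟩ := φ.flow_pos h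
    exact ⟨x', rfl, TransGen.head hx' hz⟩

theorem fplus_of_map {x y : P'.1.net.S ⊕ P'.1.net.T}
    (h : P.1.net.FPlus (Sum.map φ.f φ.g x) (Sum.map φ.f φ.g y)) : P'.1.net.FPlus x y := by
  obtain ⟨x', hx, h'⟩ := φ.fplus_reflect h
  rwa [(Function.Injective.sumMap φ.f_inj φ.g_inj) hx]

/-- The places of a prefix are determined by its transitions, being either initial or produced by
one of them. -/
theorem range_f_subset {X Y Z : GRProcess N} (φ : PrefixMap X Z) (ψ : PrefixMap Y Z)
    (h : Set.range φ.g ⊆ Set.range ψ.g) (x : X.1.net.S) : φ.f x ∈ Set.range ψ.f := by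
  rcases X.init_or_producer x with h0 | ⟨t, ht⟩
  · rw [φ.init] at h0
    exact ψ.init_mem _ (by omega)
  · rw [φ.outArc] at ht
    obtain ⟨t', ht'⟩ := h ⟨t, rfl⟩
    rw [← ht'] at ht
    exact ψ.post_mem ht

/-- Prefixes of the same process are compared by their sets of transitions. -/
theorem isPrefix_of_range_subset {X Y Z : GRProcess N} (φ : PrefixMap X Z) (ψ : PrefixMap Y Z)
    (h : Set.range φ.g ⊆ Set.range ψ.g) : X.IsPrefix Y := by
  choose f hf using range_f_subset φ ψ h
  choose g hg using fun t => h ⟨t, rfl⟩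
  refine ⟨f, g, fun a b hab => φ.f_inj ?_, fun a b hab => φ.g_inj ?_, ?_, ?_, ?_, ?_, ?_, ?_⟩
  · rw [← hf, ← hf, hab]
  · rw [← hg, ← hg, hab]
  · intro s; rw [φ.init, ψ.init, hf]
  · intro x hx
    rw [ψ.init] at hx
    obtain ⟨y, hy⟩ := φ.init_mem _ hx
    exact ⟨y, ψ.f_inj (by rw [hf, hy])⟩
  · intro s t; rw [φ.inArc, ψ.inArc, hf, hg]
  · intro s t; rw [φ.outArc, ψ.outArc, hf, hg]
  · intro s; rw [φ.mapS, ψ.mapS, hf]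
  · intro s; rw [φ.mapT, ψ.mapT, hg]

/-- Composition of embeddings. -/
def comp {P Q R : GRProcess N} (ψ : PrefixMap Q R) (φ : PrefixMap P Q) : PrefixMap P R where
  f := ψ.f ∘ φ.f
  g := ψ.g ∘ φ.g
  f_inj := ψ.f_inj.comp φ.f_inj
  g_inj := ψ.g_inj.comp φ.g_inj
  init s := (φ.init s).trans (ψ.init _)
  init_mem x hx := by
    obtain ⟨y, rfl⟩ := ψ.init_mem x hx
    obtain ⟨z, rfl⟩ := φ.init_mem y (by rw [ψ.init y]; exact hx)
    exact ⟨z, rfl⟩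
  inArc s t := (φ.inArc s t).trans (ψ.inArc _ _)
  outArc t s := (φ.outArc t s).trans (ψ.outArc _ _)
  mapS s := (φ.mapS s).trans (ψ.mapS _)
  mapT t := (φ.mapT t).trans (ψ.mapT _)

end PrefixMap

theorem IsFinite.of_isPrefix {P Q : GRProcess N} (h : P.IsPrefix Q) (hQ : Q.IsFinite) :
    P.IsFinite := by
  obtain ⟨φ⟩ := h.exists_map
  have : Finite Q.1.net.T := hQ
  exact Finite.of_injective φ.g φ.g_inj

/-- An isomorphism is a prefix embedding. -/
theorem PrefixMap.of_iso {P Q : GRProcess N} (h : P.1.Iso Q.1) : Nonempty (PrefixMap P Q) := by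
  obtain ⟨f, g, h1, h2, h3, h4, h5⟩ := h
  exact ⟨⟨f, g, f.injective, g.injective, fun s => (h1 s).symm, fun x _ => f.surjective x,
    fun s t => (h2 s t).symm, fun t s => (h3 t s).symm, h4, h5⟩⟩

theorem iso_symm {P Q : MappedNet N} (h : P.Iso Q) : Q.Iso P := by
  obtain ⟨f, g, h1, h2, h3, h4, h5⟩ := h
  refine ⟨f.symm, g.symm, fun s => ?_, fun s t => ?_, fun t s => ?_, fun s => ?_, fun t => ?_⟩
  · simpa using (h1 (f.symm s)).symm
  · simpa using (h2 (f.symm s) (g.symm t)).symm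
  · simpa using (h3 (g.symm t) (f.symm s)).symm
  · simpa using (h4 (f.symm s)).symm
  · simpa using (h5 (g.symm t)).symm

end GRProcess

/-! ### Swapping in processes -/

namespace GRProcess

variable {N : Net.{u}}

open Classical in
theorem swap_inArc (P : MappedNet N) (p q x : P.net.S) (t : P.net.T) :
    (P.swap p q).net.inArc x t = P.net.inArc (Equiv.swap p q x) t := by
  rw [Equiv.swap_apply_def]
  simp only [MappedNet.swap]
  split_ifs <;> rfl

/-- The places `p` and `q` may be swapped. -/
structure Swappable (P : GRProcess N) (p q : P.1.net.S) : Prop where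
  left : ¬ P.1.net.FPlus (.inl p) (.inl q)
  right : ¬ P.1.net.FPlus (.inl q) (.inl p)
  map_eq : P.1.mapS p = P.1.mapS q

open Classical in
theorem swap_flow (P : MappedNet N) (p q : P.net.S) {x y : P.net.S ⊕ P.net.T}
    (h : 0 < (P.swap p q).net.flow x y) :
    0 < P.net.flow x y ∨ (x = .inl p ∧ 0 < P.net.flow (.inl q) y) ∨
      (x = .inl q ∧ 0 < P.net.flow (.inl p) y) := by
  rcases x with x | x <;> rcases y with y | y
  · exact absurd h (lt_irrefl _)
  · change 0 < (P.swap p q).net.inArc x y at h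
    rw [swap_inArc, Equiv.swap_apply_def] at h
    split_ifs at h with h1 h2
    · exact Or.inr (Or.inl ⟨by rw [h1], h⟩)
    · exact Or.inr (Or.inr ⟨by rw [h2], h⟩)
    · exact Or.inl h
  · exact Or.inl h
  · exact absurd h (lt_irrefl _)

/-- A path of the swapped net uses at most one redirected arc. To use a second one it would have to
travel in `P` from `p` or `q` to `p` or `q`, which acyclicity and the incomparability of `p` and `q`
exclude. -/
theorem swap_fplus (P : GRProcess N) {p q : P.1.net.S} (hpq : P.Swappable p q)
    {x y : P.1.net.S ⊕ P.1.net.T} (h : (P.1.swap p q).net.FPlus x y) :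
    P.1.net.FPlus x y ∨
      ((x = .inl p ∨ P.1.net.FPlus x (.inl p)) ∧ P.1.net.FPlus (.inl q) y) ∨
      ((x = .inl q ∨ P.1.net.FPlus x (.inl q)) ∧ P.1.net.FPlus (.inl p) y) := by
  have key : ∀ {z y}, 0 < (P.1.swap p q).net.flow z y →
      0 < P.1.net.flow z y ∨ (z = .inl p ∧ P.1.net.FPlus (.inl q) y) ∨
      (z = .inl q ∧ P.1.net.FPlus (.inl p) y) := by
    intro z y h
    rcases swap_flow P.1 p q h with h | ⟨h1, h2⟩ | ⟨h1, h2⟩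
    · exact Or.inl h
    · exact Or.inr (Or.inl ⟨h1, TransGen.single h2⟩)
    · exact Or.inr (Or.inr ⟨h1, TransGen.single h2⟩)
  unfold Net.FPlus at h
  induction h with
  | single h =>
    rcases key h with h | ⟨h1, h2⟩ | ⟨h1, h2⟩
    · exact Or.inl (TransGen.single h)
    · exact Or.inr (Or.inl ⟨Or.inl h1, h2⟩)
    · exact Or.inr (Or.inr ⟨Or.inl h1, h2⟩)
  | tail _ h ih =>
    rcases key h with h | ⟨rfl, h2⟩ | ⟨rfl, h2⟩
    · rcases ih with ih | ⟨h1, h2⟩ | ⟨h1, h2⟩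
      · exact Or.inl (TransGen.tail ih h)
      · exact Or.inr (Or.inl ⟨h1, TransGen.tail h2 h⟩)
      · exact Or.inr (Or.inr ⟨h1, TransGen.tail h2 h⟩)
    · rcases ih with ih | ⟨h1, h3⟩ | ⟨h1, h3⟩
      · exact Or.inr (Or.inl ⟨Or.inr ih, h2⟩)
      · exact absurd h3 hpq.right
      · exact absurd h3 (P.2.acyclic _)
    · rcases ih with ih | ⟨h1, h3⟩ | ⟨h1, h3⟩
      · exact Or.inr (Or.inr ⟨Or.inr ih, h2⟩)
      · exact absurd h3 (P.2.acyclic _)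
      · exact absurd h3 hpq.left

theorem finite_past_place (P : GRProcess N) (x : P.1.net.S) :
    {t | P.1.net.FPlus (.inr t) (.inl x)}.Finite := by
  have key : ∀ t, P.1.net.FPlus (.inr t) (.inl x) → ∃ t', 0 < P.1.net.outArc t' x ∧
      (t = t' ∨ P.1.net.FPlus (.inr t) (.inr t')) := by
    intro t h
    rcases (TransGen.tail'_iff.1 h) with ⟨y, hy, hyx⟩
    rcases y with y | y
    · exact absurd hyx (lt_irrefl _)
    · refine ⟨y, hyx, ?_⟩
      rcases reflTransGen_iff_eq_or_transGen.1 hy with h | h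
      · exact Or.inl (Sum.inr_injective h).symm
      · exact Or.inr h
  by_cases h : ∃ t', 0 < P.1.net.outArc t' x
  · obtain ⟨t', ht'⟩ := h
    refine ((Set.finite_singleton t').union (P.2.finite_past t')).subset ?_
    intro t ht
    obtain ⟨t'', h1, h2⟩ := key t ht
    rw [P.2.outArc_unique _ _ _ h1 ht'] at h2
    exact h2
  · refine Set.finite_empty.subset ?_
    intro t ht
    obtain ⟨t'', h1, -⟩ := key t ht
    exact (h ⟨_, h1⟩).elim

open Classical in
theorem isProcess_swap (P : GRProcess N) {p q : P.1.net.S} (hpq : P.Swappable p q) :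
    IsProcess (P.1.swap p q) where
  outArc_le_one := P.2.outArc_le_one
  outArc_unique := P.2.outArc_unique
  inArc_le_one s t := (swap_inArc P.1 p q s t).le.trans (P.2.inArc_le_one _ _)
  inArc_unique s t t' h h' := P.2.inArc_unique _ _ _ (h.trans_eq (swap_inArc P.1 p q s t))
    (h'.trans_eq (swap_inArc P.1 p q s t'))
  init_of_pre_empty := P.2.init_of_pre_empty
  init_of_pre_nonempty := P.2.init_of_pre_nonempty
  acyclic x h := by
    rcases swap_fplus P hpq h with h | ⟨rfl | h1, h2⟩ | ⟨rfl | h1, h2⟩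
    · exact P.2.acyclic _ h
    · exact hpq.right h2
    · exact hpq.right (TransGen.trans h2 h1)
    · exact hpq.left h2
    · exact hpq.left (TransGen.trans h2 h1)
  finite_past u := by
    refine (((P.2.finite_past u).union (P.finite_past_place p)).union
      (P.finite_past_place q)).subset ?_
    intro t ht
    rcases swap_fplus P hpq ht with h | ⟨h1 | h1, h2⟩ | ⟨h1 | h1, h2⟩
    · exact Or.inl (Or.inl h)
    · cases h1
    · exact Or.inl (Or.inr h1)
    · cases h1
    · exact Or.inr h1
  map_init := P.2.map_init
  map_pre t s := by
    have : {x | P.1.mapS x = s ∧ 0 < P.1.net.inArc x t} =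
        Equiv.swap p q '' {x | P.1.mapS x = s ∧ 0 < (P.1.swap p q).net.inArc x t} := by
      have hm : ∀ x, P.1.mapS (Equiv.swap p q x) = P.1.mapS x := by
        intro x
        rw [Equiv.swap_apply_def]
        split_ifs with h1 h2
        · rw [h1, hpq.map_eq]
        · rw [h2, hpq.map_eq]
        · rfl
      ext x
      constructor
      · rintro ⟨h1, h2⟩
        refine ⟨Equiv.swap p q x, ⟨?_, ?_⟩, by simp⟩
        · rw [hm, h1]
        · refine lt_of_lt_of_eq ?_ (swap_inArc P.1 p q _ t).symm
          simpa using h2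
      · rintro ⟨y, ⟨h1, h2⟩, rfl⟩
        exact ⟨by rw [hm, h1], h2.trans_eq (swap_inArc P.1 p q y t)⟩
    have h2 := P.2.map_pre t s
    rw [this, (Equiv.injective _).encard_image] at h2
    exact h2
  map_post := P.2.map_post

/-- The process obtained by swapping. -/
noncomputable def swapped (P : GRProcess N) {p q : P.1.net.S} (hpq : P.Swappable p q) :
    GRProcess N := ⟨P.1.swap p q, P.isProcess_swap hpq⟩

theorem iso_refl (P : MappedNet N) : P.Iso P :=
  ⟨Equiv.refl _, Equiv.refl _, fun _ => rfl, fun _ _ => rfl, fun _ _ => rfl, fun _ => rfl,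
    fun _ => rfl⟩

theorem oneStepSwap_swapped (P : GRProcess N) {p q : P.1.net.S} (hpq : P.Swappable p q) :
    P.OneStepSwap (P.swapped hpq) :=
  ⟨p, q, hpq.left, hpq.right, hpq.map_eq, iso_refl _⟩

theorem OneStepSwap.exists_swapped {P Q : GRProcess N} (h : P.OneStepSwap Q) :
    ∃ (p q : P.1.net.S) (hpq : P.Swappable p q), (P.swapped hpq).1.Iso Q.1 := by
  obtain ⟨p, q, h1, h2, h3, h4⟩ := h
  exact ⟨p, q, ⟨h1, h2, h3⟩, h4⟩

theorem Swappable.map {P Q : GRProcess N} (φ : PrefixMap P Q) {p q : P.1.net.S}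
    (h : P.Swappable p q) : Q.Swappable (φ.f p) (φ.f q) where
  left h' := h.left (φ.fplus_of_map (x := .inl p) (y := .inl q) h')
  right h' := h.right (φ.fplus_of_map (x := .inl q) (y := .inl p) h')
  map_eq := by rw [← φ.mapS, ← φ.mapS, h.map_eq]

/-- Incomparability survives the swap, so that the swap can be undone. -/
theorem Swappable.swapped {P : GRProcess N} {p q : P.1.net.S}
    (h : P.Swappable p q) : (P.swapped h).Swappable p q where
  left h' := by
    rcases swap_fplus P h h' with h' | ⟨-, h'⟩ | ⟨-, h'⟩
    · exact h.left h'
    · exact P.2.acyclic _ h'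
    · exact h.left h'
  right h' := by
    rcases swap_fplus P h h' with h' | ⟨-, h'⟩ | ⟨-, h'⟩
    · exact h.right h'
    · exact h.right h'
    · exact P.2.acyclic _ h'
  map_eq := h.map_eq

open Classical in
/-- Swapping commutes with prefix embeddings. -/
noncomputable def PrefixMap.swapped {P Q : GRProcess N} (φ : PrefixMap P Q) {p q : P.1.net.S}
    (h : P.Swappable p q) : PrefixMap (P.swapped h) (Q.swapped (h.map φ)) where
  f := φ.f
  g := φ.g
  f_inj := φ.f_inj
  g_inj := φ.g_inj
  init := φ.init
  init_mem := φ.init_mem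
  inArc s t := by
    refine (swap_inArc P.1 p q s t).trans (Eq.trans ?_ (swap_inArc Q.1 _ _ _ _).symm)
    exact (φ.inArc _ _).trans (congrArg (fun x => Q.1.net.inArc x (φ.g t))
      (φ.f_inj.swap_apply p q (s : P.1.net.S)).symm)
  outArc := φ.outArc
  mapS := φ.mapS
  mapT := φ.mapT

open Classical in
theorem OneStepSwap.symm {P Q : GRProcess N} (h : P.OneStepSwap Q) : Q.OneStepSwap P := by
  obtain ⟨p, q, hpq, hiso⟩ := h.exists_swapped
  have key : ∃ (f : P.1.net.S ≃ Q.1.net.S) (g : P.1.net.T ≃ Q.1.net.T),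
      (∀ s, Q.1.net.M₀ (f s) = P.1.net.M₀ s) ∧
      (∀ s t, Q.1.net.inArc (f s) (g t) = P.1.net.inArc (Equiv.swap p q s) t) ∧
      (∀ t s, Q.1.net.outArc (g t) (f s) = P.1.net.outArc t s) ∧
      (∀ s, P.1.mapS s = Q.1.mapS (f s)) ∧
      (∀ t, P.1.mapT t = Q.1.mapT (g t)) ∧ Q.Swappable (f p) (f q) := by
    obtain ⟨f, g, h1, h2, h3, h4, h5⟩ := hiso
    let φ : PrefixMap (P.swapped hpq) Q := ⟨f, g, f.injective, g.injective, fun s => (h1 s).symm,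
      fun x _ => f.surjective x, fun s t => (h2 s t).symm, fun t s => (h3 t s).symm, h4, h5⟩
    exact ⟨f, g, h1, fun s t => (h2 s t).trans (swap_inArc P.1 p q s t), h3, h4, h5,
      hpq.swapped.map φ⟩
  obtain ⟨f, g, h1, h2, h3, h4, h5, hs⟩ := key
  refine ⟨f p, f q, hs.left, hs.right, hs.map_eq, iso_symm ⟨f, g, h1, fun s t => ?_, h3, h4, h5⟩⟩
  refine (swap_inArc Q.1 _ _ _ _).trans ?_
  refine (congrArg (fun x => Q.1.net.inArc x (g t)) (f.injective.swap_apply p q s)).trans ?_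
  rw [h2]
  simp

theorem SwapStar.symm {P Q : GRProcess N} (h : P.SwapStar Q) : Q.SwapStar P := by
  unfold SwapStar at *
  induction h with
  | refl => exact .refl
  | tail _ h ih => exact ReflTransGen.head h.symm ih

/-- Swaps in a prefix extend to the whole process. -/
theorem OneStepSwap.lift {A B C : GRProcess N} (h : B.OneStepSwap A) (hBC : B.IsPrefix C) :
    ∃ D, A.IsPrefix D ∧ C.OneStepSwap D := by
  obtain ⟨φ⟩ := hBC.exists_map
  obtain ⟨p, q, hpq, hiso⟩ := h.exists_swapped
  obtain ⟨ψ⟩ := PrefixMap.of_iso (P := A) (Q := B.swapped hpq) (iso_symm hiso)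
  exact ⟨C.swapped (hpq.map φ), ((φ.swapped hpq).comp ψ).isPrefix, oneStepSwap_swapped _ _⟩

/-- Swaps commute past extensions. This is what makes "prefix, then swaps" a transitive relation
below. -/
theorem SwapStar.lift {A B C : GRProcess N} (h : B.SwapStar A) (hBC : B.IsPrefix C) :
    ∃ D, A.IsPrefix D ∧ C.SwapStar D := by
  unfold SwapStar at *
  induction h with
  | refl => exact ⟨C, hBC, .refl⟩
  | tail _ h ih =>
    obtain ⟨D, hD, hCD⟩ := ih
    obtain ⟨E, hE, hDE⟩ := h.lift hD
    exact ⟨E, hE, hCD.tail hDE⟩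

/-! ### Prefixes up to swapping and finite approximations -/

/-- `P` is a prefix of `Q` up to finitely many swaps. -/
def PrefixUpToSwap (P Q : GRProcess N) : Prop := ∃ D : GRProcess N, P.IsPrefix D ∧ D.SwapStar Q

theorem IsPrefix.upToSwap {P Q : GRProcess N} (h : P.IsPrefix Q) : P.PrefixUpToSwap Q :=
  ⟨Q, h, .refl⟩

theorem SwapStar.upToSwap {P Q : GRProcess N} (h : P.SwapStar Q) : P.PrefixUpToSwap Q :=
  ⟨P, .refl P, h⟩

theorem PrefixUpToSwap.trans {P Q R : GRProcess N} (h : P.PrefixUpToSwap Q)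
    (h' : Q.PrefixUpToSwap R) : P.PrefixUpToSwap R := by
  obtain ⟨D, hPD, hDQ⟩ := h
  obtain ⟨E, hQE, hER⟩ := h'
  obtain ⟨F, hDF, hEF⟩ := hDQ.symm.lift hQE
  exact ⟨F, hPD.trans hDF, hEF.symm.trans hER⟩

/-- `R` is a finite approximation of `P`. -/
def Approx (R P : GRProcess N) : Prop :=
  ∃ P' : GRProcess N, P'.IsPrefix P ∧ P'.IsFinite ∧ R.PrefixUpToSwap P'

theorem Approx.of_upToSwap {R R' P : GRProcess N} (h : R.PrefixUpToSwap R') (h' : R'.Approx P) :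
    R.Approx P := by
  obtain ⟨P', h1, h2, h3⟩ := h'
  exact ⟨P', h1, h2, h.trans h3⟩

theorem Approx.mono {R P Q : GRProcess N} (h : R.Approx P) (h' : P.IsPrefix Q) : R.Approx Q := by
  obtain ⟨P', h1, h2, h3⟩ := h
  exact ⟨P', h1.trans h', h2, h3⟩

/-- Passes from classes to representatives: the two swap sequences and the prefix hidden in
`ClassLE` compose to one `PrefixUpToSwap`. -/
theorem finClass_mem_bd {R P : GRProcess N} (hR : R.IsFinite) : R.finClass ∈ P.bd ↔ R.Approx P := by
  constructor
  · rintro ⟨-, B, ⟨P', h1, h2, rfl⟩, Q', hQ', Q, hQ, hpre⟩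
    refine ⟨P', h1, h2, ?_⟩
    exact (SwapStar.upToSwap hQ').trans (hpre.upToSwap.trans (SwapStar.symm hQ).upToSwap)
  · rintro ⟨P', h1, h2, D, h3, h4⟩
    exact ⟨⟨R, hR, rfl⟩, _, ⟨P', h1, h2, rfl⟩, R, .refl, D, h4.symm, h3⟩

theorem bd_subset_iff {P Q : GRProcess N} :
    P.bd ⊆ Q.bd ↔ ∀ R : GRProcess N, R.IsFinite → R.Approx P → R.Approx Q := by
  constructor
  · intro h R hR hRP
    exact (finClass_mem_bd hR).1 (h ((finClass_mem_bd hR).2 hRP))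
  · rintro h A hA
    obtain ⟨R, hR, rfl⟩ := hA.1
    exact (finClass_mem_bd hR).2 (h R hR ((finClass_mem_bd hR).1 hA))

end GRProcess

end PetriNet

namespace PetriNet

open Relation

/-! ### Runs -/

/-- Potential tokens of a run: the index of the producing event (`none` for initial tokens), the
place, and a number distinguishing tokens with the same producer and place. -/
abbrev Tok (N : Net.{u}) := Option ℕ × N.S × ℕ

variable {N : Net.{u}}

/-- Number of tokens produced by an event on a place. -/
def mult (lab : ℕ → Option N.T) : Option ℕ → N.S → ℕ
  | none, s => N.M₀ s
  | some k, s => (lab k).elim 0 fun t => N.outArc t s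

/-- The tokens that occur in a run with labelling `lab`. -/
def IsTok (lab : ℕ → Option N.T) (x : Tok N) : Prop := x.2.2 < mult lab x.1 x.2.1

theorem IsTok.label {lab : ℕ → Option N.T} {x : Tok N} (h : IsTok lab x) {k : ℕ}
    (hk : x.1 = some k) : ∃ t, lab k = some t ∧ x.2.2 < N.outArc t x.2.1 := by
  unfold IsTok at h
  rw [hk] at h
  cases hl : lab k with
  | none => simp [mult, hl] at h
  | some t => exact ⟨t, rfl, by simpa [mult, hl] using h⟩

/-- `con` assigns to each token the event consuming it, if any.  Events are natural numbers; `lab`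
gives the transition of an event, and `none` for unused numbers. -/
structure IsRun (lab : ℕ → Option N.T) (con : Tok N → Option ℕ) : Prop where
  isTok : ∀ x k, con x = some k → IsTok lab x
  lt : ∀ x k j, con x = some k → x.1 = some j → j < k
  label : ∀ x k, con x = some k → (lab k).isSome
  card : ∀ k t, lab k = some t → ∀ s, {x : Tok N | x.2.1 = s ∧ con x = some k}.encard = N.inArc s t

theorem IsRun.finite_pre {lab : ℕ → Option N.T} {con : Tok N → Option ℕ} (h : IsRun lab con)
    (k : ℕ) : {x | con x = some k}.Finite := by
  by_cases hk : (lab k).isSome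
  · obtain ⟨t, ht⟩ := Option.isSome_iff_exists.1 hk
    have hfin : (⋃ s ∈ {s | 0 < N.inArc s t}, {x : Tok N | x.2.1 = s ∧ con x = some k}).Finite :=
      (N.pre_finite t).biUnion fun s _ => Set.finite_of_encard_eq_coe (h.card k t ht s)
    refine hfin.subset fun x hx => ?_
    simp only [Set.mem_iUnion, Set.mem_ofPred_eq, exists_prop]
    refine ⟨x.2.1, ?_, rfl, hx⟩
    have h1 := h.card k t ht x.2.1
    by_contra h0
    have h0 : N.inArc x.2.1 t = 0 := by omega
    rw [h0, Nat.cast_zero, Set.encard_eq_zero] at h1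
    have : x ∈ (∅ : Set (Tok N)) := h1 ▸ ⟨rfl, hx⟩
    exact this
  · refine Set.finite_empty.subset fun x hx => hk (h.label x k hx)

theorem finite_post (lab : ℕ → Option N.T) (k : ℕ) : {x | IsTok lab x ∧ x.1 = some k}.Finite := by
  by_cases hk : (lab k).isSome
  · obtain ⟨t, ht⟩ := Option.isSome_iff_exists.1 hk
    have hfin : (⋃ s ∈ {s | 0 < N.outArc t s},
        (fun i => ((some k, s, i) : Tok N)) '' Set.Iio (N.outArc t s)).Finite :=
      (N.post_finite t).biUnion fun s _ => (Set.finite_Iio _).image _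
    refine hfin.subset fun x hx => ?_
    obtain ⟨t', ht', hlt⟩ := hx.1.label hx.2
    obtain rfl : t = t' := Option.some_injective _ (ht.symm.trans ht')
    simp only [Set.mem_iUnion, Set.mem_ofPred_eq, exists_prop]
    refine ⟨x.2.1, by omega, x.2.2, hlt, ?_⟩
    rw [← hx.2]
  · refine Set.finite_empty.subset fun x hx => hk ?_
    obtain ⟨t, ht, -⟩ := hx.1.label hx.2
    simp [ht]

open Classical in
/-- The net of a run, with its map to `N`. -/
noncomputable def runNet {lab : ℕ → Option N.T} {con : Tok N → Option ℕ} (h : IsRun lab con) :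
    MappedNet N where
  net :=
    { S := {x : Tok N // IsTok lab x}
      T := ULift.{u} {k : ℕ // (lab k).isSome}
      inArc := fun x t => if con x.1 = some t.down.1 then 1 else 0
      outArc := fun t x => if x.1.1 = some t.down.1 then 1 else 0
      M₀ := fun x => if x.1.1 = none then 1 else 0
      pre_finite := fun t => by
        have := (h.finite_pre t.down.1).preimage (Subtype.val_injective (p := IsTok lab)).injOn
        refine this.subset fun x hx => ?_
        by_contra hne
        exact absurd hx (by simpa using hne)
      pre_nonempty := fun t => by
        obtain ⟨u, hu⟩ := Option.isSome_iff_exists.1 t.down.2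
        obtain ⟨s, hs⟩ := N.pre_nonempty u
        have h1 := h.card _ _ hu s
        have h2 : {x : Tok N | x.2.1 = s ∧ con x = some t.down.1}.Nonempty := by
          rw [Set.nonempty_iff_ne_empty]
          intro h0
          rw [h0, Set.encard_empty] at h1
          have : N.inArc s u = 0 := by exact_mod_cast h1.symm
          exact absurd hs (by simp [this])
        obtain ⟨x, -, hx⟩ := h2
        exact ⟨⟨x, h.isTok _ _ hx⟩, by simp [hx]⟩
      post_finite := fun t => by
        have := (finite_post lab t.down.1).preimage
          (Subtype.val_injective (p := IsTok lab)).injOn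
        refine this.subset fun x hx => ⟨x.2, ?_⟩
        by_contra hne
        exact absurd hx (by simpa using hne) }
  mapS := fun x => x.1.2.1
  mapT := fun t => (lab t.down.1).get t.down.2

section RunNet

variable {lab : ℕ → Option N.T} {con : Tok N → Option ℕ} (h : IsRun lab con)

theorem runNet_inArc_pos {x t} : 0 < (runNet h).net.inArc x t ↔ con x.1 = some t.down.1 := by
  simp only [runNet]
  split_ifs with h1 <;> simp [h1]

theorem runNet_outArc_pos {t x} : 0 < (runNet h).net.outArc t x ↔ x.1.1 = some t.down.1 := by
  simp only [runNet]
  split_ifs with h1 <;> simp [h1]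

theorem runNet_init_pos {x} : 0 < (runNet h).net.M₀ x ↔ x.1.1 = none := by
  simp only [runNet]
  split_ifs with h1 <;> simp [h1]

/-- A rank that increases along the flow relation of a run. -/
def runRank : (runNet h).net.S ⊕ (runNet h).net.T → ℕ
  | .inl x => x.1.1.elim 0 fun j => 2 * j + 2
  | .inr t => 2 * t.down.1 + 1

theorem runRank_lt_of_flow {x y} (hxy : 0 < (runNet h).net.flow x y) :
    runRank h x < runRank h y := by
  rcases x with x | x <;> rcases y with y | y
  · exact absurd hxy (lt_irrefl _)
  · have h1 := (runNet_inArc_pos h).1 hxy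
    have h2 := fun j => h.lt _ _ j h1
    simp only [runRank]
    cases hx : x.1.1 with
    | none => simp
    | some j => have := h2 j hx; simp only [Option.elim_some]; omega
  · have h1 := (runNet_outArc_pos h).1 hxy
    simp [runRank, h1]
  · exact absurd hxy (lt_irrefl _)

theorem runRank_lt {x y} (hxy : (runNet h).net.FPlus x y) : runRank h x < runRank h y := by
  unfold Net.FPlus at hxy
  induction hxy with
  | single h1 => exact runRank_lt_of_flow h h1
  | tail _ h1 ih => exact ih.trans (runRank_lt_of_flow h h1)

/-- Used in contrapositive form: two tokens that are present at the same moment of the run are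
causally unrelated, hence may be swapped. -/
theorem runNet_fplus_place {p q : (runNet h).net.S}
    (hpq : (runNet h).net.FPlus (.inl p) (.inl q)) :
    ∃ k j, con p.1 = some k ∧ q.1.1 = some j ∧ k ≤ j := by
  obtain ⟨y, hy, hyq⟩ := TransGen.head'_iff.1 hpq
  rcases y with y | y
  · exact absurd hy (lt_irrefl _)
  rcases reflTransGen_iff_eq_or_transGen.1 hyq with h1 | h1
  · cases h1
  have h2 := runRank_lt h h1
  have h3 := (runNet_inArc_pos h).1 hy
  simp only [runRank] at h2
  cases hq : q.1.1 with
  | none => simp [hq] at h2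
  | some j => exact ⟨_, j, h3, rfl, by simp [hq] at h2; omega⟩

theorem encard_mult (k : Option ℕ) (s : N.S) :
    {x : {x : Tok N // IsTok lab x} | x.1.2.1 = s ∧ x.1.1 = k}.encard = mult lab k s := by
  have : Subtype.val '' {x : {x : Tok N // IsTok lab x} | x.1.2.1 = s ∧ x.1.1 = k} =
      (fun i => ((k, s, i) : Tok N)) '' (Finset.range (mult lab k s) : Set ℕ) := by
    ext ⟨k', s', i⟩
    constructor
    · rintro ⟨⟨x, hx⟩, ⟨h1, h2⟩, rfl⟩
      simp only at h1 h2
      subst h1 h2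
      exact ⟨i, by simpa [IsTok] using hx, rfl⟩
    · rintro ⟨j, hj, h1⟩
      simp only [Prod.mk.injEq] at h1
      obtain ⟨rfl, rfl, rfl⟩ := h1
      exact ⟨⟨(k, s, j), by simpa [IsTok] using hj⟩, ⟨rfl, rfl⟩, rfl⟩
  rw [← Subtype.val_injective.encard_image, this, Function.Injective.encard_image,
    Set.encard_coe_eq_coe_finsetCard, Finset.card_range]
  intro i j hij
  simpa using hij

theorem encard_consumed (h : IsRun lab con) {k : ℕ} {t : N.T} (hk : lab k = some t) (s : N.S) :
    (N.inArc s t : ℕ∞) =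
      {x : {x : Tok N // IsTok lab x} | x.1.2.1 = s ∧ con x.1 = some k}.encard := by
  rw [← h.card k t hk s, ← Subtype.val_injective.encard_image]
  congr 1
  ext x
  constructor
  · rintro ⟨h1, h2⟩
    exact ⟨⟨x, h.isTok _ _ h2⟩, ⟨h1, h2⟩, rfl⟩
  · rintro ⟨⟨x, hx⟩, ⟨h1, h2⟩, rfl⟩
    exact ⟨h1, h2⟩

theorem get_eq_elim {α : Type*} {o : Option α} (ho : o.isSome) (f : α → ℕ) :
    f (o.get ho) = o.elim 0 f := by
  cases o with
  | none => simp at ho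
  | some a => rfl

theorem isProcess_runNet : IsProcess (runNet h) where
  outArc_le_one t x := by simp only [runNet]; split_ifs <;> simp
  outArc_unique x t t' h1 h2 := by
    rw [runNet_outArc_pos] at h1 h2
    exact ULift.ext _ _ (Subtype.ext (Option.some_injective _ (h1.symm.trans h2)))
  inArc_le_one x t := by simp only [runNet]; split_ifs <;> simp
  inArc_unique x t t' h1 h2 := by
    rw [runNet_inArc_pos] at h1 h2
    exact ULift.ext _ _ (Subtype.ext (Option.some_injective _ (h1.symm.trans h2)))
  init_of_pre_empty x hx := by
    have : x.1.1 = none := by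
      by_contra hne
      obtain ⟨k, hk⟩ := Option.ne_none_iff_exists'.1 hne
      obtain ⟨t, ht, -⟩ := x.2.label hk
      have := hx ⟨k, by simp [ht]⟩
      have h2 := (runNet_outArc_pos h (t := ⟨k, by simp [ht]⟩)).2 hk
      omega
    simp [runNet, this]
  init_of_pre_nonempty x hx := by
    obtain ⟨t, ht⟩ := hx
    rw [runNet_outArc_pos] at ht
    simp [runNet, ht]
  acyclic x hx := lt_irrefl _ (runRank_lt h hx)
  finite_past t := by
    have h1 : (Set.Iio t.down.1).Finite := Set.finite_Iio _
    have h2 : Function.Injective fun t : (runNet h).net.T => t.down.1 := fun a b hab =>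
      ULift.ext _ _ (Subtype.ext hab)
    refine (h1.preimage h2.injOn).subset fun t' ht' => ?_
    have := runRank_lt h ht'
    simp only [runRank] at this
    change t'.down.1 < t.down.1
    omega
  map_init s := by
    simp_rw [runNet_init_pos]
    exact (encard_mult (lab := lab) none s).symm
  map_pre t s := by
    simp_rw [runNet_inArc_pos]
    exact encard_consumed h (Option.some_get t.down.2).symm s
  map_post t s := by
    simp_rw [runNet_outArc_pos]
    refine Eq.trans ?_ (encard_mult (lab := lab) (some t.down.1) s).symm
    exact congrArg Nat.cast (get_eq_elim t.down.2 fun u => N.outArc u s)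

/-- The process of a run. -/
noncomputable def runProc : GRProcess N := ⟨runNet h, isProcess_runNet h⟩

end RunNet

/-! ### Runs with the same labelling are related by swaps -/

/-- Both tokens exist just before event `k`, and neither has been consumed by then. Exchanging their
consumers therefore keeps every consumer later than the producer. -/
theorem IsRun.swap {lab : ℕ → Option N.T} {con : Tok N → Option ℕ} (h : IsRun lab con)
    [DecidableEq (Tok N)]
    {p q : Tok N} {k : ℕ} (hs : p.2.1 = q.2.1) (hp : con p = some k)
    (hq : ∀ j, con q = some j → k < j) (hqt : IsTok lab q) (hqk : ∀ j, q.1 = some j → j < k) :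
    IsRun lab (con ∘ Equiv.swap p q) := by
  have hpt := h.isTok _ _ hp
  have hpl := fun j => h.lt _ _ j hp
  have hplace : ∀ x : Tok N, (Equiv.swap p q x).2.1 = x.2.1 := by
    intro x
    rw [Equiv.swap_apply_def]
    split_ifs with h1 h2
    · rw [h1, hs]
    · rw [h2, hs]
    · rfl
  refine ⟨fun x j hx => ?_, fun x j i hx hi => ?_, fun x j hx => h.label _ _ hx,
    fun j t hj s => ?_⟩
  · simp only [Function.comp, Equiv.swap_apply_def] at hx
    split_ifs at hx with h1 h2
    · rwa [h1]
    · rwa [h2]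
    · exact h.isTok _ _ hx
  · simp only [Function.comp, Equiv.swap_apply_def] at hx
    split_ifs at hx with h1 h2
    · subst h1
      exact (hpl i hi).trans (hq j hx)
    · subst h2
      rw [hp] at hx
      rw [← Option.some_injective _ hx]
      exact hqk i hi
    · exact h.lt _ _ _ hx hi
  · rw [← h.card j t hj s, ← (Equiv.swap p q).injective.encard_image]
    congr 1
    ext x
    constructor
    · rintro ⟨y, ⟨h1, h2⟩, rfl⟩
      exact ⟨by rw [hplace, h1], h2⟩
    · rintro ⟨h1, h2⟩
      exact ⟨Equiv.swap p q x, ⟨by rw [hplace, h1], by simpa using h2⟩, by simp⟩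

theorem IsRun.oneStepSwap {lab : ℕ → Option N.T} {con : Tok N → Option ℕ} (h : IsRun lab con)
    [DecidableEq (Tok N)]
    {p q : Tok N} {k : ℕ} (hs : p.2.1 = q.2.1) (hp : con p = some k)
    (hq : ∀ j, con q = some j → k < j) (hqt : IsTok lab q) (hqk : ∀ j, q.1 = some j → j < k)
    (h' : IsRun lab (con ∘ Equiv.swap p q)) : (runProc h).OneStepSwap (runProc h') := by
  classical
  refine ⟨⟨p, h.isTok _ _ hp⟩, ⟨q, hqt⟩, fun hf => ?_, fun hf => ?_, hs, Equiv.refl _,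
    Equiv.refl _, fun _ => rfl, fun x t => ?_, fun _ _ => rfl, fun _ => rfl, fun _ => rfl⟩
  · obtain ⟨i, j, h1, h2, h3⟩ := runNet_fplus_place h hf
    simp only [hp, Option.some.injEq] at h1
    have := hqk j h2
    omega
  · obtain ⟨i, j, h1, h2, h3⟩ := runNet_fplus_place h hf
    have := hq i h1
    have := h.lt _ _ j hp h2
    omega
  · refine Eq.trans ?_ (GRProcess.swap_inArc (runNet h) _ _ x t).symm
    have := @Function.Injective.swap_apply {x // IsTok lab x} (Tok N)
      (fun a b => Classical.propDecidable (a = b)) _ _ Subtype.val_injective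
      ⟨p, h.isTok _ _ hp⟩ ⟨q, hqt⟩ x
    simp only [runProc, runNet, Function.comp]
    congr 3

/-- Let `k` be the least event involved in a disagreement. On the place of a disputed token it
consumes equally many tokens in both runs, so there are `p` consumed by `k` only in `c₁` and `q`
consumed by `k` only in `c₂`. Swapping `p` and `q` in `c₁` settles `q` and creates no new
disagreement. -/
theorem runProc_swapStar {lab : ℕ → Option N.T} {c₁ c₂ : Tok N → Option ℕ} (h₁ : IsRun lab c₁)
    (h₂ : IsRun lab c₂) (hfin : {x | c₁ x ≠ c₂ x}.Finite) :
    (runProc h₁).SwapStar (runProc h₂) := by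
  classical
  induction hn : {x | c₁ x ≠ c₂ x}.ncard using Nat.strong_induction_on generalizing c₁ with
  | _ n ih =>
    by_cases hne : ∃ x, c₁ x ≠ c₂ x
    · have hex : ∃ k x, c₁ x ≠ c₂ x ∧ (c₁ x = some k ∨ c₂ x = some k) := by
        obtain ⟨x, hx⟩ := hne
        cases h1 : c₁ x with
        | some k => exact ⟨k, x, hx, Or.inl h1⟩
        | none =>
          cases h2 : c₂ x with
          | some k => exact ⟨k, x, hx, Or.inr h2⟩
          | none => exact absurd (h1.trans h2.symm) hx
      obtain ⟨x, hx, hxk⟩ := Nat.find_spec hex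
      have hmin := fun j (hj : j < Nat.find hex) => Nat.find_min hex hj
      set k := Nat.find hex
      have hk : (lab k).isSome := by
        rcases hxk with h | h
        · exact h₁.label _ _ h
        · exact h₂.label _ _ h
      obtain ⟨t, ht⟩ := Option.isSome_iff_exists.1 hk
      have hA := h₁.card k t ht x.2.1
      have hB := h₂.card k t ht x.2.1
      set A := {y : Tok N | y.2.1 = x.2.1 ∧ c₁ y = some k}
      set B := {y : Tok N | y.2.1 = x.2.1 ∧ c₂ y = some k}
      have hAfin : A.Finite := Set.finite_of_encard_eq_coe hA
      have hBfin : B.Finite := Set.finite_of_encard_eq_coe hB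
      have hAB : A ≠ B := by
        intro hAB
        rcases hxk with h | h
        · have h3 : x ∈ B := hAB ▸ (⟨rfl, h⟩ : x ∈ A)
          exact hx (h.trans h3.2.symm)
        · have h3 : x ∈ A := hAB.symm ▸ (⟨rfl, h⟩ : x ∈ B)
          exact hx (h3.2.trans h.symm)
      obtain ⟨p, ⟨hp1, hp2⟩, hpB⟩ : ∃ p ∈ A, p ∉ B := by
        by_contra! hsub
        exact hAB (hAfin.eq_of_subset_of_encard_le hsub (by rw [hA, hB]))
      obtain ⟨q, ⟨hq1, hq2⟩, hqA⟩ : ∃ q ∈ B, q ∉ A := by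
        by_contra! hsub
        exact hAB.symm (hBfin.eq_of_subset_of_encard_le hsub (by rw [hA, hB]))
      have hpB : c₂ p ≠ some k := fun h => hpB ⟨hp1, h⟩
      have hqA : c₁ q ≠ some k := fun h => hqA ⟨hq1, h⟩
      -- An earlier consumer of `q` in `c₁` would be a disagreement below the minimal `k`, so `q` is
      -- still present when `k` fires.
      have hq : ∀ j, c₁ q = some j → k < j := by
        intro j hj
        by_contra hjk
        have hjk' : j ≠ k := by rintro rfl; exact hqA hj
        exact hmin j (by omega) ⟨q, by rw [hq2]; exact hqA, Or.inl hj⟩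
      have h' := h₁.swap (hp1.trans hq1.symm) hp2 hq (h₂.isTok _ _ hq2) (fun j => h₂.lt _ _ j hq2)
      have hstep := h₁.oneStepSwap (hp1.trans hq1.symm) hp2 hq (h₂.isTok _ _ hq2)
        (fun j => h₂.lt _ _ j hq2) h'
      have hss : {x | (c₁ ∘ Equiv.swap p q) x ≠ c₂ x} ⊂ {x | c₁ x ≠ c₂ x} := by
        rw [Set.ssubset_iff_of_subset]
        · refine ⟨q, by rw [Set.mem_ofPred_eq, hq2]; exact hqA, ?_⟩
          simp [hp2, hq2]
        · intro y hy
          simp only [Set.mem_ofPred_eq, Function.comp, Equiv.swap_apply_def] at hy ⊢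
          split_ifs at hy with h1 h2
          · rw [h1, hp2]; exact hpB.symm
          · rw [h2, hp2, hq2] at hy; exact absurd rfl hy
          · exact hy
      exact ReflTransGen.head hstep
        (ih _ (by rw [← hn]; exact Set.ncard_lt_ncard hss hfin) h' (hfin.subset hss.subset) rfl)
    · push Not at hne
      obtain rfl : c₁ = c₂ := funext hne
      exact .refl

/-- A labelling with finitely many events. -/
def Bounded (lab : ℕ → Option N.T) (n : ℕ) : Prop := ∀ k, n ≤ k → lab k = none

theorem IsRun.finite_con {lab : ℕ → Option N.T} {con : Tok N → Option ℕ} (h : IsRun lab con) {n : ℕ}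
    (hn : Bounded lab n) : {x | con x ≠ none}.Finite := by
  refine ((Set.finite_Iio n).biUnion fun k _ => h.finite_pre k).subset fun x hx => ?_
  obtain ⟨k, hk⟩ := Option.ne_none_iff_exists'.1 hx
  simp only [Set.mem_iUnion]
  refine ⟨k, ?_, hk⟩
  by_contra hkn
  have := h.label _ _ hk
  rw [hn k (by simpa using hkn)] at this
  simp at this

theorem runProc_swapStar_of_bounded {l₁ l₂ : ℕ → Option N.T} {c₁ c₂ : Tok N → Option ℕ}
    (h₁ : IsRun l₁ c₁) (h₂ : IsRun l₂ c₂) (hl : l₁ = l₂) {n : ℕ} (hn : Bounded l₁ n) :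
    (runProc h₁).SwapStar (runProc h₂) := by
  subst hl
  refine runProc_swapStar h₁ h₂ (((h₁.finite_con hn).union (h₂.finite_con hn)).subset ?_)
  intro x hx
  by_contra hne
  simp only [Set.mem_union, Set.mem_ofPred_eq, not_or, not_not] at hne
  exact hx (hne.1.trans hne.2.symm)

/-! ### Restricting a run to a set of events -/

open Classical in
/-- The labelling with events outside of `X` removed. -/
noncomputable def restrictLab (lab : ℕ → Option N.T) (X : Set ℕ) (k : ℕ) : Option N.T :=
  if k ∈ X then lab k else none

open Classical in
/-- The consumption function with events outside of `X` removed. -/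
noncomputable def restrictCon (con : Tok N → Option ℕ) (X : Set ℕ) (x : Tok N) : Option ℕ :=
  (con x).bind fun k => if k ∈ X then some k else none

theorem restrictCon_eq_some {con : Tok N → Option ℕ} {X : Set ℕ} {x : Tok N} {k : ℕ} :
    restrictCon con X x = some k ↔ con x = some k ∧ k ∈ X := by
  unfold restrictCon
  cases con x with
  | none => simp
  | some j =>
    simp only [Option.bind_some, Option.some.injEq]
    split_ifs with h
    · simp only [Option.some.injEq]
      exact ⟨fun hjk => ⟨hjk, hjk ▸ h⟩, fun hjk => hjk.1⟩
    · simp only [false_iff, not_and]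
      rintro rfl
      exact h

theorem restrictLab_eq_some {lab : ℕ → Option N.T} {X : Set ℕ} {k : ℕ} {t : N.T} :
    restrictLab lab X k = some t ↔ lab k = some t ∧ k ∈ X := by
  unfold restrictLab
  split_ifs with h <;> simp [h]

theorem restrictLab_of_mem {lab : ℕ → Option N.T} {X : Set ℕ} {k : ℕ} (h : k ∈ X) :
    restrictLab lab X k = lab k := if_pos h

theorem restrictLab_of_not_mem {lab : ℕ → Option N.T} {X : Set ℕ} {k : ℕ} (h : k ∉ X) :
    restrictLab lab X k = none := if_neg h

theorem mult_restrictLab {lab : ℕ → Option N.T} {X : Set ℕ} {k : Option ℕ}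
    (hk : ∀ j, k = some j → j ∈ X) (s : N.S) : mult (restrictLab lab X) k s = mult lab k s := by
  cases k with
  | none => rfl
  | some j => simp only [mult, restrictLab_of_mem (hk j rfl)]

theorem IsTok.of_restrictLab {lab : ℕ → Option N.T} {X : Set ℕ} {x : Tok N}
    (h : IsTok (restrictLab lab X) x) : IsTok lab x := by
  unfold IsTok
  rwa [← mult_restrictLab (X := X)]
  intro j hj
  obtain ⟨t, ht, -⟩ := h.label hj
  exact (restrictLab_eq_some.1 ht).2

/-- The hypothesis on `X` is causal closure: a remaining event never consumes a token of a removed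
one. -/
theorem IsRun.restrict {lab : ℕ → Option N.T} {con : Tok N → Option ℕ} (h : IsRun lab con)
    {X : Set ℕ} (hX : ∀ x k j, con x = some k → k ∈ X → x.1 = some j → j ∈ X) :
    IsRun (restrictLab lab X) (restrictCon con X) where
  isTok x k hx := by
    rw [restrictCon_eq_some] at hx
    unfold IsTok
    rw [mult_restrictLab fun j hj => hX x k j hx.1 hx.2 hj]
    exact h.isTok x k hx.1
  lt x k j hx := h.lt x k j (restrictCon_eq_some.1 hx).1
  label x k hx := by
    rw [restrictCon_eq_some] at hx
    rw [restrictLab_of_mem hx.2]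
    exact h.label x k hx.1
  card k t hk s := by
    rw [restrictLab_eq_some] at hk
    rw [← h.card k t hk.1 s]
    congr 1
    ext x
    simp only [Set.mem_ofPred_eq, restrictCon_eq_some, hk.2, and_true]

/-- The restriction of a run is a prefix. -/
noncomputable def IsRun.restrictMap {lab : ℕ → Option N.T} {con : Tok N → Option ℕ}
    (h : IsRun lab con) {X : Set ℕ} (h' : IsRun (restrictLab lab X) (restrictCon con X)) :
    GRProcess.PrefixMap (runProc h') (runProc h) where
  f x := ⟨x.1, x.2.of_restrictLab⟩
  g t := ⟨t.down.1, by
    obtain ⟨u, hu⟩ := Option.isSome_iff_exists.1 t.down.2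
    simp [(restrictLab_eq_some.1 hu).1]⟩
  f_inj a b hab := Subtype.ext (show a.1 = b.1 from congrArg (Subtype.val (p := IsTok lab)) hab)
  g_inj a b hab := ULift.ext _ _ (Subtype.ext (congrArg (fun t => t.down.1) hab))
  init _ := rfl
  init_mem x hx := ⟨⟨x.1, by
    have := (runNet_init_pos h).1 hx
    unfold IsTok
    rw [mult_restrictLab fun j hj => by rw [this] at hj; cases hj]
    exact x.2⟩, rfl⟩
  inArc x t := by
    obtain ⟨u, hu⟩ := Option.isSome_iff_exists.1 t.down.2
    have := (restrictLab_eq_some.1 hu).2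
    simp only [runProc, runNet, restrictCon_eq_some, this, and_true]
  outArc _ _ := rfl
  mapS _ := rfl
  mapT t := by
    obtain ⟨u, hu⟩ := Option.isSome_iff_exists.1 t.down.2
    have := (restrictLab_eq_some.1 hu).2
    simp only [runProc, runNet, restrictLab_of_mem this]

theorem IsRun.restrict_isPrefix {lab : ℕ → Option N.T} {con : Tok N → Option ℕ}
    (h : IsRun lab con) {X : Set ℕ} (h' : IsRun (restrictLab lab X) (restrictCon con X)) :
    (runProc h').IsPrefix (runProc h) := (h.restrictMap h').isPrefix

theorem IsRun.trunc {lab : ℕ → Option N.T} {con : Tok N → Option ℕ} (h : IsRun lab con) (n : ℕ) :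
    IsRun (restrictLab lab (Set.Iio n)) (restrictCon con (Set.Iio n)) :=
  h.restrict fun x k j hx hk hj => (h.lt x k j hx hj).trans hk

theorem bounded_trunc (lab : ℕ → Option N.T) (n : ℕ) :
    Bounded (restrictLab lab (Set.Iio n)) n := fun k hk =>
  restrictLab_of_not_mem (by simpa using hk)

theorem restrictLab_eq_self {lab : ℕ → Option N.T} {n : ℕ} (h : Bounded lab n) :
    restrictLab lab (Set.Iio n) = lab := by
  funext k
  by_cases hk : k < n
  · exact restrictLab_of_mem hk
  · rw [restrictLab_of_not_mem (by simpa using hk), h k (by omega)]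

theorem Bounded.mono {lab : ℕ → Option N.T} {n m : ℕ} (h : Bounded lab n) (hnm : n ≤ m) :
    Bounded lab m := fun k hk => h k (hnm.trans hk)

theorem IsRun.isFinite {lab : ℕ → Option N.T} {con : Tok N → Option ℕ} (h : IsRun lab con) {n : ℕ}
    (hn : Bounded lab n) : (runProc h).IsFinite := by
  have : Function.Injective fun t : (runNet h).net.T => (⟨t.down.1, by
      by_contra hk
      have := t.down.2
      rw [hn _ (not_lt.1 hk)] at this
      simp at this⟩ : Fin n) := fun a b hab =>
    ULift.ext _ _ (Subtype.ext (by simpa using hab))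
  exact Finite.of_injective _ this

theorem IsRun.bounded_of_isFinite {lab : ℕ → Option N.T} {con : Tok N → Option ℕ}
    (h : IsRun lab con) (hfin : (runProc h).IsFinite) : ∃ n, Bounded lab n := by
  have : Finite (runNet h).net.T := hfin
  obtain ⟨n, hn⟩ := (Set.finite_range fun t : (runNet h).net.T => t.down.1).bddAbove
  refine ⟨n + 1, fun k hk => ?_⟩
  by_contra hne
  have := hn ⟨⟨⟨k, Option.isSome_iff_ne_none.2 hne⟩⟩, rfl⟩
  simp only at this
  omega

/-- Finite prefixes of a run are contained in finite truncations. -/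
theorem IsRun.exists_trunc {lab : ℕ → Option N.T} {con : Tok N → Option ℕ} (h : IsRun lab con)
    {Q : GRProcess N} (hQ : Q.IsPrefix (runProc h)) (hfin : Q.IsFinite) :
    ∃ n₀, ∀ n, n₀ ≤ n → Q.IsPrefix (runProc (h.trunc n)) := by
  obtain ⟨φ⟩ := hQ.exists_map
  have : Finite Q.1.net.T := hfin
  obtain ⟨n, hn⟩ := (Set.finite_range fun t : Q.1.net.T =>
    (φ.g t : (runNet h).net.T).down.1).bddAbove
  refine ⟨n + 1, fun m hm => φ.isPrefix_of_range_subset (h.restrictMap (h.trunc m)) ?_⟩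
  rintro _ ⟨t, rfl⟩
  have h1 : (φ.g t : (runNet h).net.T).down.1 < m := by
    have := hn ⟨t, rfl⟩
    simp only at this
    omega
  exact ⟨⟨⟨(φ.g t : (runNet h).net.T).down.1,
    (congrArg Option.isSome (restrictLab_of_mem (lab := lab) (X := Set.Iio m) h1)).trans
      (φ.g t : (runNet h).net.T).down.2⟩⟩, rfl⟩

/-- The truncation of the second run has the same finite labelling as the first run, so the two
differ by swaps only. Consumption functions need not be compared from here on. -/
theorem runProc_approx_of_eq {l₁ l₂ : ℕ → Option N.T} {c₁ c₂ : Tok N → Option ℕ}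
    (h₁ : IsRun l₁ c₁) (h₂ : IsRun l₂ c₂) (n : ℕ)
    (hl : l₁ = restrictLab l₂ (Set.Iio n)) : (runProc h₁).Approx (runProc h₂) :=
  ⟨_, h₂.restrict_isPrefix (h₂.trunc n), (h₂.trunc n).isFinite (bounded_trunc _ _),
    (runProc_swapStar_of_bounded h₁ (h₂.trunc n) hl (n := n)
      (hl ▸ bounded_trunc _ _)).upToSwap⟩

/-- The class of a run depends on its labelling only. -/
theorem bd_runProc_congr {l₁ l₂ : ℕ → Option N.T} {c₁ c₂ : Tok N → Option ℕ}
    (h₁ : IsRun l₁ c₁) (h₂ : IsRun l₂ c₂) (hl : l₁ = l₂) :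
    (runProc h₁).bd = (runProc h₂).bd := by
  have key : ∀ {l₁ l₂ : ℕ → Option N.T} {c₁ c₂ : Tok N → Option ℕ}
    (h₁ : IsRun l₁ c₁) (h₂ : IsRun l₂ c₂) (_ : l₁ = l₂),
      (runProc h₁).bd ⊆ (runProc h₂).bd := by
    intro l₁ l₂ c₁ c₂ h₁ h₂ hl
    rw [GRProcess.bd_subset_iff]
    rintro R - ⟨P', hP', hfin, hR⟩
    obtain ⟨n, hn⟩ := h₁.exists_trunc hP' hfin
    refine .of_upToSwap (hR.trans (hn n le_rfl).upToSwap) ?_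
    exact runProc_approx_of_eq (h₁.trunc n) h₂ n (by rw [hl])
  exact (key h₁ h₂ hl).antisymm (key h₂ h₁ hl.symm)

end PetriNet

namespace PetriNet

open Relation

variable {N : Net.{u}}

/-! ### Every process is the process of a run -/

namespace GRProcess

theorem PrefixMap.fplus_map {P' P : GRProcess N} (φ : PrefixMap P' P)
    {x y : P'.1.net.S ⊕ P'.1.net.T} (h : P'.1.net.FPlus x y) :
    P.1.net.FPlus (Sum.map φ.f φ.g x) (Sum.map φ.f φ.g y) := by
  refine TransGen.lift (Sum.map φ.f φ.g) (fun a b hab => ?_) _ _ h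
  rcases a with a | a <;> rcases b with b | b
  · exact absurd hab (lt_irrefl _)
  · exact lt_of_lt_of_eq hab (φ.inArc a b)
  · exact lt_of_lt_of_eq hab (φ.outArc a b)
  · exact absurd hab (lt_irrefl _)

theorem fplus_of_arcs (P : GRProcess N) {t t' : P.1.net.T} {x : P.1.net.S}
    (h : 0 < P.1.net.outArc t x) (h' : 0 < P.1.net.inArc x t') :
    P.1.net.FPlus (.inr t) (.inr t') := by
  have h1 : 0 < P.1.net.flow (.inr t) (.inl x) := h
  have h2 : 0 < P.1.net.flow (.inl x) (.inr t') := h'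
  exact TransGen.head h1 (TransGen.single h2)

theorem countable_init [Countable N.S] (P : GRProcess N) : {x | 0 < P.1.net.M₀ x}.Countable := by
  have : {x | 0 < P.1.net.M₀ x} = ⋃ s, {x | P.1.mapS x = s ∧ 0 < P.1.net.M₀ x} := by
    ext x; simp
  rw [this]
  exact Set.countable_iUnion fun s => (Set.finite_of_encard_eq_coe (P.2.map_init s).symm).countable

theorem past_ssubset (P : GRProcess N) {t t' : P.1.net.T} (h : P.1.net.FPlus (.inr t) (.inr t')) :
    {v | v = t ∨ P.1.net.FPlus (.inr v) (.inr t)} ⊂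
      {v | v = t' ∨ P.1.net.FPlus (.inr v) (.inr t')} := by
  rw [Set.ssubset_iff_of_subset]
  · refine ⟨t', Or.inl rfl, ?_⟩
    rintro (rfl | h')
    · exact P.2.acyclic _ h
    · exact P.2.acyclic _ (h.trans h')
  · rintro v (rfl | hv)
    · exact Or.inr h
    · exact Or.inr (hv.trans h)

theorem finite_past' (P : GRProcess N) (t : P.1.net.T) :
    {v | v = t ∨ P.1.net.FPlus (.inr v) (.inr t)}.Finite :=
  (Set.finite_singleton t).union (P.2.finite_past t)

/-- A transition is determined by any one of its preplaces. Such a preplace is either initial, and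
there are countably many of these, or produced by a transition with a smaller past, which allows
induction on the size `d` of the past. -/
theorem countable_transitions [Countable N.S] (P : GRProcess N) : Countable P.1.net.T := by
  set d : P.1.net.T → ℕ := fun t => {v | v = t ∨ P.1.net.FPlus (.inr v) (.inr t)}.ncard with hd
  choose ψ hψ using P.1.net.pre_nonempty
  have hinj : Function.Injective ψ := fun a b hab =>
    P.2.inArc_unique _ _ _ (hψ a) (hab ▸ hψ b)
  have key : ∀ n, {t | d t < n}.Countable := by
    intro n
    induction n with
    | zero => simp
    | succ n ih =>
      have h1 : ({x | 0 < P.1.net.M₀ x} ∪ ⋃ t ∈ {t | d t < n},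
          {x | 0 < P.1.net.outArc t x}).Countable :=
        P.countable_init.union (ih.biUnion fun t _ => (P.1.net.post_finite t).countable)
      refine (h1.preimage hinj).mono fun t ht => ?_
      rcases P.init_or_producer (ψ t) with h0 | ⟨t', ht'⟩
      · exact Or.inl (show 0 < _ by omega)
      · refine Or.inr ?_
        simp only [Set.mem_iUnion]
        refine ⟨t', ?_, ht'⟩
        have h2 : P.1.net.FPlus (.inr t') (.inr t) := P.fplus_of_arcs ht' (hψ t)
        have h3 : d t' < d t := Set.ncard_lt_ncard (P.past_ssubset h2) (P.finite_past' t)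
        have ht : d t < n + 1 := ht
        change d t' < n
        omega
  rw [← Set.countable_univ_iff]
  refine (Set.countable_iUnion key).mono fun t _ => ?_
  exact Set.mem_iUnion.2 ⟨d t + 1, Nat.lt_succ_self _⟩

/-- The transitions of a process can be numbered along the causal order. -/
theorem exists_numbering [Countable N.S] (P : GRProcess N) : ∃ h : P.1.net.T → ℕ,
    Function.Injective h ∧ ∀ t t', P.1.net.FPlus (.inr t) (.inr t') → h t < h t' := by
  classical
  have := P.countable_transitions
  obtain ⟨e, he⟩ := Countable.exists_injective_nat P.1.net.T
  set A : P.1.net.T → Finset ℕ := fun t => (P.finite_past' t).toFinset.image e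
  have hA : ∀ t t', t = t' ∨ P.1.net.FPlus (.inr t) (.inr t') ↔ e t ∈ A t' := by
    intro t t'
    simp only [A, Finset.mem_image, Set.Finite.mem_toFinset]
    constructor
    · intro h
      exact ⟨t, h, rfl⟩
    · rintro ⟨v, hv, hvt⟩
      rwa [← he hvt]
  -- The number of `t` encodes its finite past in binary. It determines the past, hence `t` by
  -- acyclicity, and it grows strictly with the past.
  refine ⟨fun t => ∑ i ∈ A t, 2 ^ i, fun t t' htt' => ?_, fun t t' htt' => ?_⟩
  · have h1 : A t = A t' := Finset.geomSum_injective le_rfl htt'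
    rcases (hA t t').2 (h1 ▸ (hA t t).1 (Or.inl rfl)) with h2 | h2
    · exact h2
    rcases (hA t' t).2 (h1 ▸ (hA t' t').1 (Or.inl rfl)) with h3 | h3
    · exact h3.symm
    · exact absurd (h2.trans h3) (P.2.acyclic _)
  · have hss := P.past_ssubset htt'
    refine Finset.sum_lt_sum_of_subset (i := e t') ?_ ((hA t' t').1 (Or.inl rfl)) ?_
      (by positivity) (fun _ _ _ => by positivity)
    · exact Finset.image_subset_image (by simpa using hss.subset)
    · rw [← hA]
      rintro (rfl | h')
      · exact P.2.acyclic _ htt'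
      · exact P.2.acyclic _ (htt'.trans h')

/-- A process whose transitions are numbered along the causal order is the process of a run. -/
theorem exists_run_of_numbering (P : GRProcess N) (h : P.1.net.T → ℕ) (hinj : Function.Injective h)
    (hmono : ∀ t t', P.1.net.FPlus (.inr t) (.inr t') → h t < h t') :
    ∃ (lab : ℕ → Option N.T) (con : Tok N → Option ℕ) (hr : IsRun lab con),
      P.1.Iso (runNet hr) ∧ (∀ t, lab (h t) = some (P.1.mapT t)) ∧
      ∀ k, lab k ≠ none → ∃ t, h t = k := by
  classical
  have hlab : ∃ lab : ℕ → Option N.T, (∀ t, lab (h t) = some (P.1.mapT t)) ∧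
      ∀ k, lab k ≠ none → ∃ t, h t = k := by
    refine ⟨fun k => if H : ∃ t, h t = k then some (P.1.mapT H.choose) else none,
      fun t => ?_, fun k hk => ?_⟩
    · have H : ∃ t', h t' = h t := ⟨t, rfl⟩
      simp only [H, dif_pos]
      rw [hinj H.choose_spec]
    · by_contra hne
      simp [hne] at hk
  obtain ⟨lab, hlab, hlab'⟩ := hlab
  have hprod : ∃ pr : P.1.net.S → Option P.1.net.T,
      ∀ x t, pr x = some t ↔ 0 < P.1.net.outArc t x := by
    refine ⟨fun x => if H : ∃ t, 0 < P.1.net.outArc t x then some H.choose else none,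
      fun x t => ?_⟩
    dsimp only
    split_ifs with H
    · rw [Option.some.injEq]
      exact ⟨fun ht => ht ▸ H.choose_spec, fun ht => P.2.outArc_unique _ _ _ H.choose_spec ht⟩
    · simp only [false_iff]
      exact fun ht => H ⟨t, ht⟩
  obtain ⟨pr, hpr⟩ := hprod
  have hpr0 : ∀ x, pr x = none ↔ 0 < P.1.net.M₀ x := by
    intro x
    constructor
    · intro hx
      rcases P.init_or_producer x with h0 | ⟨t, ht⟩
      · omega
      · rw [← hpr, hx] at ht
        cases ht
    · intro hx
      by_contra hne
      obtain ⟨t, ht⟩ := Option.ne_none_iff_exists'.1 hne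
      have := P.2.init_of_pre_nonempty x ⟨t, (hpr x t).1 ht⟩
      omega
  have hcard : ∀ o s, {x | P.1.mapS x = s ∧ pr x = o}.encard = (mult lab (o.map h) s : ℕ∞) := by
    intro o s
    cases o with
    | none => simp only [hpr0]; exact (P.2.map_init s).symm
    | some t =>
      simp only [hpr, Option.map_some, mult, hlab, Option.elim_some]
      exact (P.2.map_post t s).symm
  -- Places with the same producer and the same image are numbered arbitrarily by an initial segment
  -- of `ℕ`; this is the third component of a token.
  have hbij : ∀ o s, ∃ i : P.1.net.S → ℕ, Set.BijOn i {x | P.1.mapS x = s ∧ pr x = o}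
      (Set.Iio (mult lab (o.map h) s)) := by
    intro o s
    refine (Set.finite_of_encard_eq_coe (hcard o s)).exists_bijOn_of_encard_eq ?_
    rw [hcard, ← Finset.coe_Iio, Set.encard_coe_eq_coe_finsetCard]
    simp
  choose i hi using hbij
  set φ : P.1.net.S → Tok N := fun x => ((pr x).map h, P.1.mapS x, i (pr x) (P.1.mapS x) x) with hφ
  have φ_inj : Function.Injective φ := by
    intro a b hab
    simp only [hφ, Prod.mk.injEq] at hab
    obtain ⟨h1, h2, h3⟩ := hab
    have h1 := Option.map_injective hinj h1
    rw [h1, h2] at h3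
    exact (hi _ _).injOn ⟨h2, h1⟩ ⟨rfl, rfl⟩ h3
  have φ_tok : ∀ x, IsTok lab (φ x) := fun x => (hi _ _).mapsTo ⟨rfl, rfl⟩
  have φ_surj : ∀ y, IsTok lab y → ∃ x, φ x = y := by
    rintro ⟨k, s, j⟩ hy
    have hk : ∃ o : Option P.1.net.T, o.map h = k := by
      cases k with
      | none => exact ⟨none, rfl⟩
      | some k =>
        obtain ⟨u, hu, -⟩ := hy.label rfl
        obtain ⟨t, rfl⟩ := hlab' k (by simp [hu])
        exact ⟨some t, rfl⟩
    obtain ⟨o, rfl⟩ := hk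
    obtain ⟨x, ⟨h1, h2⟩, h3⟩ := (hi o s).surjOn hy
    refine ⟨x, ?_⟩
    simp only [hφ]
    rw [h2, h1, h3]
  have hcon : ∃ con : Tok N → Option ℕ,
      ∀ y k, con y = some k ↔ ∃ x t, φ x = y ∧ 0 < P.1.net.inArc x t ∧ h t = k := by
    refine ⟨fun y => if H : ∃ k x t, φ x = y ∧ 0 < P.1.net.inArc x t ∧ h t = k then
      some H.choose else none, fun y k => ?_⟩
    dsimp only
    split_ifs with H
    · rw [Option.some.injEq]
      constructor
      · rintro rfl
        exact H.choose_spec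
      · rintro ⟨x, t, rfl, h2, rfl⟩
        obtain ⟨x', t', h1', h2', h3'⟩ := H.choose_spec
        rw [← h3']
        obtain rfl := φ_inj h1'
        rw [P.2.inArc_unique _ _ _ h2 h2']
    · simp only [false_iff]
      exact fun h' => H ⟨k, h'⟩
  obtain ⟨con, hcon⟩ := hcon
  have hcon' : ∀ x t, con (φ x) = some (h t) ↔ 0 < P.1.net.inArc x t := by
    intro x t
    rw [hcon]
    constructor
    · rintro ⟨x', t', h1, h2, h3⟩
      rwa [← φ_inj h1, ← hinj h3]
    · intro h1
      exact ⟨x, t, rfl, h1, rfl⟩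
  have hr : IsRun lab con := by
    refine ⟨fun y k hy => ?_, fun y k j hy hj => ?_, fun y k hy => ?_, fun k u hk s => ?_⟩
    · obtain ⟨x, t, rfl, -, -⟩ := (hcon y k).1 hy
      exact φ_tok x
    · obtain ⟨x, t, rfl, h1, rfl⟩ := (hcon y k).1 hy
      simp only [hφ, Option.map_eq_some_iff] at hj
      obtain ⟨t', ht', rfl⟩ := hj
      rw [hpr] at ht'
      exact hmono _ _ (P.fplus_of_arcs ht' h1)
    · obtain ⟨x, t, rfl, h1, rfl⟩ := (hcon y k).1 hy
      simp [hlab]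
    · obtain ⟨t, rfl⟩ := hlab' k (by simp [hk])
      obtain rfl : P.1.mapT t = u := by simpa [hlab] using hk
      rw [P.2.map_pre t s, ← φ_inj.encard_image]
      congr 1
      ext y
      constructor
      · rintro ⟨h1, h2⟩
        obtain ⟨x, t', rfl, h3, h4⟩ := (hcon y _).1 h2
        exact ⟨x, ⟨h1, hinj h4 ▸ h3⟩, rfl⟩
      · rintro ⟨x, ⟨h1, h2⟩, rfl⟩
        exact ⟨h1, (hcon' x t).2 h2⟩
  refine ⟨lab, con, hr, ?_, hlab, hlab'⟩
  let f : P.1.net.S → (runNet hr).net.S := fun x => ⟨φ x, φ_tok x⟩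
  let g : P.1.net.T → (runNet hr).net.T := fun t => ⟨⟨h t, by simp [hlab]⟩⟩
  have hf : Function.Bijective f := by
    refine ⟨fun a b hab => φ_inj (congrArg Subtype.val hab), fun y => ?_⟩
    obtain ⟨x, hx⟩ := φ_surj y.1 y.2
    exact ⟨x, Subtype.ext hx⟩
  have hg : Function.Bijective g := by
    refine ⟨fun a b hab => hinj (congrArg (fun t : (runNet hr).net.T => t.down.1) hab),
      fun k => ?_⟩
    obtain ⟨t, ht⟩ := hlab' k.down.1 (Option.isSome_iff_ne_none.1 k.down.2)
    exact ⟨t, ULift.ext _ _ (Subtype.ext ht)⟩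
  -- All arc weights and initial markings of processes are 0 or 1, so comparing positivity is
  -- enough.
  have hle : ∀ {a b : ℕ}, a ≤ 1 → b ≤ 1 → (0 < a ↔ 0 < b) → a = b := by omega
  have hP := isProcess_runNet hr
  refine ⟨Equiv.ofBijective f hf, Equiv.ofBijective g hg, fun x => ?_, fun x t => ?_,
    fun t x => ?_, fun x => rfl, fun t => ?_⟩
  · have h1 : P.1.net.M₀ x ≤ 1 := by
      rcases P.init_or_producer x with h0 | h0
      · omega
      · have := P.2.init_of_pre_nonempty x h0
        omega
    refine hle ?_ h1 (Iff.trans (runNet_init_pos hr) ?_)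
    · simp only [runNet]; split_ifs <;> simp
    · rw [← hpr0]
      change (pr x).map h = none ↔ _
      simp
  · refine hle (hP.inArc_le_one _ _) (P.2.inArc_le_one _ _) (Iff.trans (runNet_inArc_pos hr) ?_)
    exact hcon' x t
  · refine hle (hP.outArc_le_one _ _) (P.2.outArc_le_one _ _)
      (Iff.trans (runNet_outArc_pos hr) ?_)
    rw [← hpr]
    change (pr x).map h = some (h t) ↔ _
    rw [← Option.map_some, (Option.map_injective hinj).eq_iff]
  · refine Option.some_injective _ ?_
    rw [← hlab]
    exact (Option.some_get _).symm

theorem exists_run [Countable N.S] (P : GRProcess N) :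
    ∃ (lab : ℕ → Option N.T) (con : Tok N → Option ℕ) (hr : IsRun lab con),
      P.1.Iso (runProc hr).1 := by
  obtain ⟨h, h1, h2⟩ := P.exists_numbering
  obtain ⟨lab, con, hr, hiso, -⟩ := P.exists_run_of_numbering h h1 h2
  exact ⟨lab, con, hr, hiso⟩

theorem isPrefix_of_iso {P Q : GRProcess N} (h : P.1.Iso Q.1) : P.IsPrefix Q := by
  obtain ⟨φ⟩ := PrefixMap.of_iso h
  exact φ.isPrefix

theorem bd_eq_of_iso {P Q : GRProcess N} (h : P.1.Iso Q.1) : P.bd = Q.bd :=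
  (bd_mono (isPrefix_of_iso h)).antisymm (bd_mono (isPrefix_of_iso (iso_symm h)))

/-- An extension of a finite run is, up to isomorphism, a run whose labelling extends the given
one; an unused event number can be kept free. -/
theorem exists_run_extending [Countable N.S] {lab : ℕ → Option N.T} {con : Tok N → Option ℕ}
    {hr : IsRun lab con} {m : ℕ} (hm : Bounded lab m) {D : GRProcess N}
    (hD : (runProc hr).IsPrefix D) :
    ∃ (lab' : ℕ → Option N.T) (con' : Tok N → Option ℕ) (hr' : IsRun lab' con'),
      D.1.Iso (runProc hr').1 ∧ (∀ k, k < m → lab' k = lab k) ∧ lab' m = none := by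
  classical
  obtain ⟨φ⟩ := hD.exists_map
  obtain ⟨h₀, hinj, hmono⟩ := D.exists_numbering
  set idx : (runProc hr).1.net.T → ℕ := fun t => (t : (runNet hr).net.T).down.1 with hidx
  have idx_inj : Function.Injective idx := fun a b hab => ULift.ext _ _ (Subtype.ext hab)
  have idx_lt : ∀ t, idx t < m := by
    intro t
    by_contra hlt
    have := (t : (runNet hr).net.T).down.2
    rw [hm _ (not_lt.1 hlt)] at this
    simp at this
  -- Events of the prefix keep their numbers, which are below `m`. The new ones are shifted by `m +
  -- 1` rather than `m`, which leaves `m` free for a later insertion.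
  have hh : ∃ h : D.1.net.T → ℕ, (∀ t, h (φ.g t) = idx t) ∧
      ∀ t, t ∉ Set.range φ.g → h t = h₀ t + m + 1 := by
    refine ⟨fun t => if H : t ∈ Set.range φ.g then idx H.choose else h₀ t + m + 1,
      fun t => ?_, fun t ht => dif_neg ht⟩
    have H : φ.g t ∈ Set.range φ.g := ⟨t, rfl⟩
    exact (dif_pos H).trans (congrArg idx (φ.g_inj H.choose_spec))
  obtain ⟨h, h1, h2⟩ := hh
  obtain ⟨lab', con', hr', hiso, h3, h4⟩ := D.exists_run_of_numbering h (fun a b hab => by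
    by_cases ha : a ∈ Set.range φ.g
    · obtain ⟨a, rfl⟩ := ha
      by_cases hb : b ∈ Set.range φ.g
      · obtain ⟨b, rfl⟩ := hb
        rw [h1, h1] at hab
        rw [idx_inj hab]
      · rw [h1, h2 b hb] at hab
        have := idx_lt a
        omega
    · by_cases hb : b ∈ Set.range φ.g
      · obtain ⟨b, rfl⟩ := hb
        rw [h1, h2 a ha] at hab
        have := idx_lt b
        omega
      · rw [h2 a ha, h2 b hb] at hab
        exact hinj (by omega)) (fun a b hab => by
    -- An event of the prefix has no predecessor outside of it, and every new event has a number
    -- above `m`.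
    by_cases hb : b ∈ Set.range φ.g
    · obtain ⟨b, rfl⟩ := hb
      obtain ⟨x, hx, hxb⟩ := φ.fplus_reflect (y := .inr b) hab
      rcases x with x | x
      · cases hx
      · obtain rfl := Sum.inr_injective hx
        rw [h1, h1]
        have := runRank_lt hr hxb
        simp only [runRank] at this
        simp only [hidx]
        omega
    · rw [h2 b hb]
      by_cases ha : a ∈ Set.range φ.g
      · obtain ⟨a, rfl⟩ := ha
        rw [h1]
        have := idx_lt a
        omega
      · rw [h2 a ha]
        have := hmono _ _ hab
        omega)
  refine ⟨lab', con', hr', hiso, fun k hk => ?_, ?_⟩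
  · cases hl : lab k with
    | some u =>
      let t : (runProc hr).1.net.T := (⟨⟨k, by simp [hl]⟩⟩ : (runNet hr).net.T)
      have h5 := h3 (φ.g t)
      rw [h1, ← φ.mapT t] at h5
      refine h5.trans ?_
      rw [← hl]
      exact Option.some_get _
    | none =>
      by_contra hne
      obtain ⟨t, ht⟩ := h4 k hne
      by_cases htr : t ∈ Set.range φ.g
      · obtain ⟨t, rfl⟩ := htr
        rw [h1] at ht
        have := (t : (runNet hr).net.T).down.2
        change (lab (idx t)).isSome at this
        rw [ht, hl] at this
        simp at this
      · rw [h2 t htr] at ht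
        omega
  · by_contra hne
    obtain ⟨t, ht⟩ := h4 m hne
    by_cases htr : t ∈ Set.range φ.g
    · obtain ⟨t, rfl⟩ := htr
      rw [h1] at ht
      have := idx_lt t
      omega
    · rw [h2 t htr] at ht
      omega

/-! ### Swapping preserves the finite approximations -/

/-- Finite prefixes can be enlarged to finite prefixes containing two given places. -/
theorem exists_finite_prefix [Countable N.S] {D P : GRProcess N} (hP : P.IsPrefix D)
    (hfin : P.IsFinite) (p q : D.1.net.S) :
    ∃ (E : GRProcess N) (χ : PrefixMap E D), E.IsFinite ∧ P.IsPrefix E ∧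
      p ∈ Set.range χ.f ∧ q ∈ Set.range χ.f := by
  obtain ⟨lab, con, hr, hiso⟩ := D.exists_run
  obtain ⟨n₀, hn₀⟩ := hr.exists_trunc (hP.trans (isPrefix_of_iso hiso)) hfin
  have hback : ∃ ψ : PrefixMap (runProc hr) D, Function.Surjective ψ.f := by
    obtain ⟨f, g, h1, h2, h3, h4, h5⟩ := iso_symm hiso
    exact ⟨⟨f, g, f.injective, g.injective, fun s => (h1 s).symm, fun x _ => f.surjective x,
      fun s t => (h2 s t).symm, fun t s => (h3 t s).symm, h4, h5⟩, f.surjective⟩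
  obtain ⟨ψ, hψ⟩ := hback
  have htok : ∀ x : {x // IsTok lab x}, ∃ n₁, ∀ n, n₁ ≤ n →
      IsTok (restrictLab lab (Set.Iio n)) x.1 := by
    intro x
    -- A token of event `j` survives truncation as soon as `j < n`, an initial token always.
    refine ⟨x.1.1.elim 0 (· + 1), fun n hn => ?_⟩
    unfold IsTok
    rw [mult_restrictLab]
    · exact x.2
    · intro j hj
      simp only [hj, Option.elim_some] at hn
      exact hn
  obtain ⟨p', rfl⟩ := hψ p
  obtain ⟨q', rfl⟩ := hψ q
  obtain ⟨n₁, hn₁⟩ := htok p'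
  obtain ⟨n₂, hn₂⟩ := htok q'
  set n := max n₀ (max n₁ n₂)
  refine ⟨runProc (hr.trunc n), ψ.comp (hr.restrictMap (hr.trunc n)),
    (hr.trunc n).isFinite (bounded_trunc _ _), hn₀ n (le_max_left _ _), ?_, ?_⟩
  · exact ⟨⟨p'.1, hn₁ n ((le_max_left _ _).trans (le_max_right _ _))⟩, rfl⟩
  · exact ⟨⟨q'.1, hn₂ n ((le_max_right _ _).trans (le_max_right _ _))⟩, rfl⟩

/-- A finite prefix may contain only one of the two swapped places, or neither. Once it is enlarged
to contain both, the swap can be carried out inside it. -/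
theorem OneStepSwap.bd_subset [Countable N.S] {D P : GRProcess N} (h : D.OneStepSwap P) :
    D.bd ⊆ P.bd := by
  obtain ⟨p, q, hpq, hiso⟩ := h.exists_swapped
  rw [bd_subset_iff]
  rintro R - ⟨P', hP', hfin, hR⟩
  obtain ⟨E, χ, hE, hPE, ⟨p, rfl⟩, ⟨q, rfl⟩⟩ := exists_finite_prefix hP' hfin p q
  have hpq' : E.Swappable p q :=
    ⟨fun hf => hpq.left (χ.fplus_map hf), fun hf => hpq.right (χ.fplus_map hf), by
      rw [χ.mapS, χ.mapS, hpq.map_eq]⟩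
  refine ⟨E.swapped hpq', (χ.swapped hpq').isPrefix.trans (isPrefix_of_iso hiso), hE, ?_⟩
  exact hR.trans (hPE.upToSwap.trans
    (SwapStar.upToSwap (ReflTransGen.single (E.oneStepSwap_swapped hpq'))))

theorem SwapStar.bd_eq [Countable N.S] {D P : GRProcess N} (h : D.SwapStar P) : D.bd = P.bd := by
  unfold SwapStar at h
  induction h with
  | refl => rfl
  | tail _ h ih => exact ih.trans (h.bd_subset.antisymm h.symm.bd_subset)

/-- An approximation is a prefix of a swapping equivalent process. -/
theorem Approx.exists_prefix [Countable N.S] {R P : GRProcess N} (h : R.Approx P) :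
    ∃ D : GRProcess N, R.IsPrefix D ∧ D.SwapStar P := by
  obtain ⟨P', h1, -, h2⟩ := h
  exact h2.trans h1.upToSwap

end GRProcess

end PetriNet

namespace PetriNet

variable {N : Net.{u}}

/-! ### Markings along a labelling -/

open Classical in
/-- The marking before event `k`, where tokens produced by the events in `bad` are ignored. -/
noncomputable def marking (lab : ℕ → Option N.T) (bad : Set ℕ) : ℕ → N.S → ℕ
  | 0, s => N.M₀ s
  | k + 1, s => marking lab bad k s - ((lab k).elim 0 fun t => N.inArc s t) +
      if k ∈ bad then 0 else mult lab (some k) s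

/-- All events of `lab` can fire in succession, without tokens produced by the events in `bad`. -/
def Firable (lab : ℕ → Option N.T) (bad : Set ℕ) : Prop :=
  ∀ k t, lab k = some t → ∀ s, N.inArc s t ≤ marking lab bad k s

theorem marking_congr {l₁ l₂ : ℕ → Option N.T} (bad : Set ℕ) {n : ℕ}
    (h : ∀ k, k < n → l₁ k = l₂ k) : marking l₁ bad n = marking l₂ bad n := by
  induction n with
  | zero => rfl
  | succ n ih =>
    funext s
    simp only [marking, mult, ih fun k hk => h k (by omega), h n (by omega)]

/-! ### Realising a firable labelling by a run -/

open Classical in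
/-- Some subset of `A` with `n` elements, if there is one. -/
noncomputable def pick {α : Type*} (A : Finset α) (n : ℕ) : Finset α :=
  if h : n ≤ A.card then (Finset.exists_subset_card_eq h).choose else ∅

theorem pick_subset {α : Type*} (A : Finset α) (n : ℕ) : pick A n ⊆ A := by
  unfold pick
  split_ifs with h
  · exact (Finset.exists_subset_card_eq h).choose_spec.1
  · simp

theorem card_pick {α : Type*} {A : Finset α} {n : ℕ} (h : n ≤ A.card) : (pick A n).card = n := by
  unfold pick
  rw [dif_pos h]
  exact (Finset.exists_subset_card_eq h).choose_spec.2

open Classical in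
/-- The tokens on place `s` that are produced by event `k`. -/
noncomputable def produced (lab : ℕ → Option N.T) (k : Option ℕ) (s : N.S) : Finset (Tok N) :=
  (Finset.range (mult lab k s)).image fun i => (k, s, i)

theorem mem_produced {lab : ℕ → Option N.T} {k : Option ℕ} {s : N.S} {x : Tok N} :
    x ∈ produced lab k s ↔ x.1 = k ∧ x.2.1 = s ∧ IsTok lab x := by
  obtain ⟨k', s', i⟩ := x
  simp only [produced, Finset.mem_image, Finset.mem_range, Prod.mk.injEq, IsTok]
  constructor
  · rintro ⟨j, hj, rfl, rfl, rfl⟩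
    exact ⟨rfl, rfl, hj⟩
  · rintro ⟨rfl, rfl, h⟩
    exact ⟨i, h, rfl, rfl, rfl⟩

open Classical in
theorem card_produced (lab : ℕ → Option N.T) (k : Option ℕ) (s : N.S) :
    (produced lab k s).card = mult lab k s := by
  unfold produced
  rw [Finset.card_image_of_injective _ fun i j hij => by simpa using hij, Finset.card_range]

open Classical in
/-- The tokens available before event `k` when each event consumes picked available tokens not
produced by the events in `bad`. -/
noncomputable def avail (lab : ℕ → Option N.T) (bad : Set ℕ) : ℕ → N.S → Finset (Tok N)
  | 0, s => produced lab none s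
  | k + 1, s =>
    (avail lab bad k s \ pick (avail lab bad k s) ((lab k).elim 0 fun t => N.inArc s t)) ∪
      if k ∈ bad then ∅ else produced lab (some k) s

/-- The tokens on place `s` consumed by event `k`. -/
noncomputable def used (lab : ℕ → Option N.T) (bad : Set ℕ) (k : ℕ) (s : N.S) : Finset (Tok N) :=
  pick (avail lab bad k s) ((lab k).elim 0 fun t => N.inArc s t)

theorem mem_avail_succ {lab : ℕ → Option N.T} {bad : Set ℕ} {k : ℕ} {s : N.S} {x : Tok N} :
    x ∈ avail lab bad (k + 1) s ↔ (x ∈ avail lab bad k s ∧ x ∉ used lab bad k s) ∨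
      (k ∉ bad ∧ x ∈ produced lab (some k) s) := by
  simp only [avail, used, Finset.mem_union, Finset.mem_sdiff]
  split_ifs with h <;> simp [h]

theorem avail_spec {lab : ℕ → Option N.T} {bad : Set ℕ} {k : ℕ} {s : N.S} {x : Tok N}
    (h : x ∈ avail lab bad k s) :
    x.2.1 = s ∧ IsTok lab x ∧ ∀ j, x.1 = some j → j < k ∧ j ∉ bad := by
  induction k with
  | zero =>
    obtain ⟨h1, h2, h3⟩ := mem_produced.1 h
    exact ⟨h2, h3, fun j hj => by rw [h1] at hj; cases hj⟩
  | succ k ih =>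
    rcases mem_avail_succ.1 h with h | ⟨hk, h⟩
    · obtain ⟨h1, h2, h3⟩ := ih h.1
      exact ⟨h1, h2, fun j hj => ⟨(h3 j hj).1.trans (Nat.lt_succ_self k), (h3 j hj).2⟩⟩
    · obtain ⟨h1, h2, h3⟩ := mem_produced.1 h
      refine ⟨h2, h3, fun j hj => ?_⟩
      rw [h1] at hj
      cases hj
      exact ⟨Nat.lt_succ_self k, hk⟩

-- Firability ensures that each pick finds enough tokens, and freshly produced tokens are distinct
-- from the old ones, so the sets of available tokens follow the recursion for markings.
open Classical in
theorem card_avail {lab : ℕ → Option N.T} {bad : Set ℕ} (h : Firable lab bad) (k : ℕ) (s : N.S) :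
    (avail lab bad k s).card = marking lab bad k s := by
  induction k with
  | zero => exact card_produced lab none s
  | succ k ih =>
    have hle : ((lab k).elim 0 fun t => N.inArc s t) ≤ (avail lab bad k s).card := by
      cases hk : lab k with
      | none => simp
      | some t => rw [ih]; exact h k t hk s
    have hdisj : Disjoint
        (avail lab bad k s \ pick (avail lab bad k s) ((lab k).elim 0 fun t => N.inArc s t))
        (if k ∈ bad then ∅ else produced lab (some k) s) := by
      rw [Finset.disjoint_left]
      intro x hx hx'
      split_ifs at hx' with hb
      · simp at hx'
      · have := (avail_spec (Finset.mem_sdiff.1 hx).1).2.2 k (mem_produced.1 hx').1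
        omega
    simp only [avail, marking]
    rw [Finset.card_union_of_disjoint hdisj, Finset.card_sdiff_of_subset (pick_subset _ _),
      card_pick hle, ih]
    split_ifs <;> simp [card_produced]

theorem used_not_avail {lab : ℕ → Option N.T} {bad : Set ℕ} {k j : ℕ} {s : N.S} {x : Tok N}
    (h : x ∈ used lab bad k s) (hkj : k < j) : x ∉ avail lab bad j s := by
  have hx := (avail_spec (pick_subset _ _ h)).2.2
  induction j, hkj using Nat.le_induction with
  | base =>
    intro h'
    rcases mem_avail_succ.1 h' with h' | ⟨-, h'⟩
    · exact h'.2 h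
    · have := hx k (mem_produced.1 h').1
      omega
  | succ j hj ih =>
    intro h'
    rcases mem_avail_succ.1 h' with h' | ⟨-, h'⟩
    · exact ih h'.1
    · have := hx j (mem_produced.1 h').1
      omega

theorem used_unique {lab : ℕ → Option N.T} {bad : Set ℕ} {k j : ℕ} {s : N.S} {x : Tok N}
    (h : x ∈ used lab bad k s) (h' : x ∈ used lab bad j s) : k = j := by
  rcases lt_trichotomy k j with hkj | hkj | hkj
  · exact absurd (pick_subset _ _ h') (used_not_avail h hkj)
  · exact hkj
  · exact absurd (pick_subset _ _ h) (used_not_avail h' hkj)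

/-- A firable labelling carries a run. -/
theorem Firable.exists_run {lab : ℕ → Option N.T} {bad : Set ℕ} (h : Firable lab bad) :
    ∃ con, IsRun lab con ∧ ∀ x k j, con x = some k → x.1 = some j → j ∉ bad := by
  classical
  have hcon : ∃ con : Tok N → Option ℕ, ∀ x k, con x = some k ↔ x ∈ used lab bad k x.2.1 := by
    refine ⟨fun x => if H : ∃ k, x ∈ used lab bad k x.2.1 then some H.choose else none,
      fun x k => ?_⟩
    dsimp only
    split_ifs with H
    · rw [Option.some.injEq]
      exact ⟨fun hk => hk ▸ H.choose_spec, fun hk => used_unique H.choose_spec hk⟩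
    · simp only [false_iff]
      exact fun hk => H ⟨k, hk⟩
  obtain ⟨con, hcon⟩ := hcon
  have hav : ∀ x k, con x = some k → x ∈ avail lab bad k x.2.1 := fun x k hx =>
    pick_subset _ _ ((hcon x k).1 hx)
  have hcard : ∀ k t, lab k = some t → ∀ s, (used lab bad k s).card = N.inArc s t := by
    intro k t hk s
    unfold used
    rw [hk]
    exact card_pick (by rw [card_avail h]; exact h k t hk s)
  refine ⟨con, ⟨fun x k hx => (avail_spec (hav x k hx)).2.1,
    fun x k j hx hj => ((avail_spec (hav x k hx)).2.2 j hj).1, fun x k hx => ?_,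
    fun k t hk s => ?_⟩, fun x k j hx hj => ((avail_spec (hav x k hx)).2.2 j hj).2⟩
  · by_contra hk
    have hk : lab k = none := by simpa using hk
    have h1 := (hcon x k).1 hx
    have h2 : (used lab bad k x.2.1).card = 0 := by
      unfold used
      rw [hk]
      exact card_pick (Nat.zero_le _)
    rw [Finset.card_eq_zero] at h2
    simp [h2] at h1
  · rw [← hcard k t hk s, ← Set.encard_coe_eq_coe_finsetCard]
    congr 1
    ext x
    constructor
    · rintro ⟨rfl, h2⟩
      exact (hcon x k).1 h2
    · intro h2
      have h3 := (avail_spec (pick_subset _ _ h2)).1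
      exact ⟨h3, (hcon x k).2 (by rw [h3]; exact h2)⟩

/-- The number of unconsumed tokens in a run is given by the marking. -/
theorem IsRun.encard_marking {lab : ℕ → Option N.T} {con : Tok N → Option ℕ} (h : IsRun lab con)
    (k : ℕ) (s : N.S) :
    {x : Tok N | x.2.1 = s ∧ IsTok lab x ∧ (∀ j, x.1 = some j → j < k) ∧
      ∀ j, con x = some j → k ≤ j}.encard = marking lab ∅ k s ∧
    ((lab k).elim 0 fun t => N.inArc s t) ≤ marking lab ∅ k s := by
  set A : ℕ → Set (Tok N) := fun k => {x : Tok N | x.2.1 = s ∧ IsTok lab x ∧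
    (∀ j, x.1 = some j → j < k) ∧ ∀ j, con x = some j → k ≤ j} with hA
  set U : ℕ → Set (Tok N) := fun k => {x : Tok N | x.2.1 = s ∧ con x = some k} with hU
  have hUcard : ∀ k, (U k).encard = (((lab k).elim 0 fun t => N.inArc s t : ℕ) : ℕ∞) := by
    intro k
    cases hk : lab k with
    | some t => exact h.card k t hk s
    | none =>
      simp only [Option.elim_none, Nat.cast_zero, Set.encard_eq_zero]
      refine Set.eq_empty_of_forall_notMem fun x hx => ?_
      have := h.label x k hx.2
      simp [hk] at this
  have hUA : ∀ k, U k ⊆ A k := by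
    rintro k x ⟨h1, h2⟩
    refine ⟨h1, h.isTok _ _ h2, fun j hj => h.lt _ _ _ h2 hj, fun j hj => ?_⟩
    rw [h2] at hj
    exact (Option.some_injective _ hj).le
  have hle : ∀ k, (A k).encard = marking lab ∅ k s →
      ((lab k).elim 0 fun t => N.inArc s t) ≤ marking lab ∅ k s := by
    intro k hk
    have := Set.encard_le_encard (hUA k)
    rw [hUcard, hk] at this
    exact_mod_cast this
  suffices hmain : (A k).encard = marking lab ∅ k s from ⟨hmain, hle k hmain⟩
  induction k with
  | zero =>
    rw [show marking lab ∅ 0 s = mult lab none s from rfl, ← card_produced,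
      ← Set.encard_coe_eq_coe_finsetCard]
    congr 1
    ext x
    rw [Finset.mem_coe, mem_produced]
    constructor
    · rintro ⟨h1, h2, h3, -⟩
      refine ⟨?_, h1, h2⟩
      by_contra hne
      obtain ⟨j, hj⟩ := Option.ne_none_iff_exists'.1 hne
      exact absurd (h3 j hj) (Nat.not_lt_zero j)
    · rintro ⟨h1, h2, h3⟩
      refine ⟨h2, h3, fun j hj => ?_, fun j _ => Nat.zero_le j⟩
      rw [h1] at hj
      cases hj
  | succ k ih =>
    have hk := hle k ih
    -- Token balance of event `k`: what remains together with what `k` consumes is what was there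
    -- together with what `k` produces. Both unions are disjoint, so counting gives the recursion
    -- for markings.
    have hunion : A (k + 1) ∪ U k = A k ∪ produced lab (some k) s := by
      ext x
      simp only [Set.mem_union, Finset.mem_coe, mem_produced]
      constructor
      · rintro (⟨h1, h2, h3, h4⟩ | hx)
        · by_cases hxk : x.1 = some k
          · exact Or.inr ⟨hxk, h1, h2⟩
          · refine Or.inl ⟨h1, h2, fun j hj => ?_, fun j hj => (h4 j hj).trans' (by omega)⟩
            have h5 := h3 j hj
            have : j ≠ k := by rintro rfl; exact hxk hj
            omega
        · exact Or.inl (hUA k hx)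
      · rintro (⟨h1, h2, h3, h4⟩ | ⟨h1, h2, h3⟩)
        · by_cases hxk : con x = some k
          · exact Or.inr ⟨h1, hxk⟩
          · refine Or.inl ⟨h1, h2, fun j hj => (h3 j hj).trans (by omega), fun j hj => ?_⟩
            have h5 := h4 j hj
            have : j ≠ k := by rintro rfl; exact hxk hj
            omega
        · refine Or.inl ⟨h2, h3, fun j hj => ?_, fun j hj => h.lt _ _ _ hj h1⟩
          rw [h1] at hj
          have := Option.some_injective _ hj
          omega
    have hd1 : Disjoint (A (k + 1)) (U k) := by
      rw [Set.disjoint_left]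
      rintro x ⟨-, -, -, h4⟩ ⟨-, h2⟩
      have := h4 k h2
      omega
    have hd2 : Disjoint (A k) (produced lab (some k) s : Set (Tok N)) := by
      rw [Set.disjoint_left]
      rintro x ⟨-, -, h3, -⟩ h2
      have := h3 k (mem_produced.1 (Finset.mem_coe.1 h2)).1
      omega
    have hsum := congrArg Set.encard hunion
    rw [Set.encard_union_eq hd1, Set.encard_union_eq hd2, hUcard, ih,
      Set.encard_coe_eq_coe_finsetCard, card_produced] at hsum
    simp only [marking, Set.mem_empty_iff_false, if_false]
    -- Cancellation needs finite cardinalities.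
    have hne : (A (k + 1)).encard ≠ ⊤ := by
      intro htop
      rw [htop, top_add] at hsum
      exact absurd hsum.symm (by exact_mod_cast ENat.natCast_ne_top _)
    obtain ⟨a, ha⟩ := ENat.ne_top_iff_exists.1 hne
    rw [← ha] at hsum ⊢
    norm_cast at hsum ⊢
    omega

theorem IsRun.firable {lab : ℕ → Option N.T} {con : Tok N → Option ℕ} (h : IsRun lab con) :
    Firable lab ∅ := by
  intro k t hk s
  have := (h.encard_marking k s).2
  rwa [hk] at this

/-! ### Reachability and conflict freeness -/

theorem preSet_single (t : N.T) (s : N.S) : N.preSet (Finsupp.single t 1) s = N.inArc s t := by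
  simp [Net.preSet]

theorem postSet_single (t : N.T) (s : N.S) : N.postSet (Finsupp.single t 1) s = N.outArc t s := by
  simp [Net.postSet]

theorem fires_concat {M M' M'' : N.S → ℕ} {σ : List N.T} {t : N.T} (h : N.Fires M σ M')
    (h' : N.Step M' (Finsupp.single t 1) M'') : N.Fires M (σ ++ [t]) M'' := by
  induction σ generalizing M with
  | nil =>
    obtain rfl : M = M' := h
    exact ⟨M'', h', rfl⟩
  | cons v σ ih =>
    obtain ⟨M₁, h1, h2⟩ := h
    exact ⟨M₁, h1, ih h2⟩

/-- Unused event numbers leave the marking unchanged; the others extend the firing sequence by one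
transition. -/
theorem Firable.reachable {lab : ℕ → Option N.T} (h : Firable lab ∅) (k : ℕ) :
    N.Reachable (marking lab ∅ k) := by
  induction k with
  | zero => exact ⟨[], rfl⟩
  | succ k ih =>
    cases hk : lab k with
    | none =>
      have : marking lab ∅ (k + 1) = marking lab ∅ k := by
        funext s
        simp [marking, mult, hk]
      rwa [this]
    | some t =>
      obtain ⟨σ, hσ⟩ := ih
      refine ⟨σ ++ [t], fires_concat hσ ⟨by simp, fun s => ?_, ?_⟩⟩
      · rw [preSet_single]
        exact h k t hk s
      · funext s
        simp [marking, mult, hk, preSet_single, postSet_single]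

/-- As `t ≠ v`, the restrictions of the multiset `t + v` to its members are single transitions, both
enabled, so the absence of conflict makes the pair fire together. For `t = v` the restriction would
be the pair itself and nothing would follow. -/
theorem Net.BinaryConflictFree.add_le (hN : N.BinaryConflictFree) {M : N.S → ℕ}
    (hM : N.Reachable M) {t v : N.T} (htv : t ≠ v) (ht : ∀ s, N.inArc s t ≤ M s)
    (hv : ∀ s, N.inArc s v ≤ M s) (s : N.S) : N.inArc s t + N.inArc s v ≤ M s := by
  classical
  have h := hN M hM (Finsupp.single t 1 + Finsupp.single v 1) (by
    rw [map_add, Finsupp.degree_single, Finsupp.degree_single])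
  unfold Net.InConflict at h
  push Not at h
  obtain ⟨M', -, h2, -⟩ := h fun w hw => by
    rcases eq_or_ne w t with rfl | hwt
    · refine ⟨_, by simp [htv], fun s => ?_, rfl⟩
      simpa [preSet_single, htv] using ht s
    · rcases eq_or_ne w v with rfl | hwv
      · refine ⟨_, by simp [htv], fun s => ?_, rfl⟩
        simpa [preSet_single, htv] using hv s
      · simp [hwt.symm, hwv.symm] at hw
  have h3 := h2 s
  unfold Net.preSet at h3
  rw [Finsupp.sum_add_index' (by simp) (by intros; ring)] at h3
  simpa using h3

/-- In a conflict-free net an enabled transition can be inserted, and its firing does not take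
tokens away from later events labelled differently. -/
theorem Firable.insert (hN : N.BinaryConflictFree) {lab : ℕ → Option N.T} (h : Firable lab ∅)
    {k : ℕ} (hk : lab k = none) {v : N.T} (hv : ∀ s, N.inArc s v ≤ marking lab ∅ k s)
    (hne : ∀ j, k ≤ j → lab j ≠ some v) : Firable (Function.update lab k (some v)) {k} := by
  obtain ⟨lab', hlab'⟩ : ∃ lab', lab' = Function.update lab k (some v) := ⟨_, rfl⟩
  rw [← hlab']
  have hself : lab' k = some v := by rw [hlab', Function.update_self]
  have hother : ∀ j, j ≠ k → lab' j = lab j := fun j hj => by rw [hlab', Function.update_of_ne hj]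
  have hlt : ∀ j, j ≤ k → marking lab' {k} j = marking lab ∅ j := by
    intro j hj
    induction j with
    | zero => rfl
    | succ j ih =>
      have hjk : j ≠ k := by omega
      funext s
      simp [marking, mult, ih (by omega), hother j hjk, hjk]
  -- If the new marking lacks exactly the preset of `v`, then `v` is enabled in the old one, next to
  -- `t ≠ v`. Both fit into the old marking, so `t` fits into the new one.
  have hstep : ∀ j, k < j → (∀ s, marking lab' {k} j s + N.inArc s v = marking lab ∅ j s) →
      ∀ t, lab j = some t → ∀ s, N.inArc s t ≤ marking lab' {k} j s := by
    intro j hj hm t ht s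
    have htv : t ≠ v := by
      rintro rfl
      exact hne j hj.le ht
    have := hN.add_le (h.reachable j) htv (h j t ht) (fun s => by rw [← hm]; omega) s
    have := hm s
    omega
  -- The deficit arises at `k`, whose products are ignored, and later events do not change it.
  have hgt : ∀ j, k < j → ∀ s, marking lab' {k} j s + N.inArc s v = marking lab ∅ j s := by
    intro j hj
    induction j, hj using Nat.le_induction with
    | base =>
      intro s
      have h1 := hv s
      simp only [marking, hlt k le_rfl, hself, hk, mult]
      simp only [Option.elim_some, Set.mem_singleton_iff, if_true, Option.elim_none,
        Set.mem_empty_iff_false, if_false]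
      omega
    | succ j hj ih =>
      intro s
      have hjk : j ≠ k := by omega
      have h1 := ih s
      cases hl : lab j with
      | none =>
        simp [marking, mult, hother j hjk, hjk, hl] at h1 ⊢
        exact h1
      | some t =>
        have h2 := hstep j hj ih t hl s
        simp only [marking, mult, hother j hjk, hl, Option.elim_some,
          Set.mem_singleton_iff, hjk, if_false, Set.mem_empty_iff_false] at h1 h2 ⊢
        omega
  intro j t ht s
  rcases lt_trichotomy j k with hj | rfl | hj
  · rw [hlt j hj.le]
    rw [hother j hj.ne] at ht
    exact h j t ht s
  · rw [hlt j le_rfl]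
    rw [hself] at ht
    obtain rfl := Option.some_injective _ ht
    exact hv s
  · rw [hother j hj.ne'] at ht
    exact hstep j hj (hgt j hj) t ht s

end PetriNet

namespace PetriNet

open Relation

variable {N : Net.{u}}

/-! ### Merging finite approximations -/

namespace GRProcess

theorem Approx.congr {R P Q : GRProcess N} (hR : R.IsFinite) (h : R.Approx P) (hPQ : P.bd = Q.bd) :
    R.Approx Q := bd_subset_iff.1 hPQ.subset R hR h

theorem Approx.refl {P : GRProcess N} (h : P.IsFinite) : P.Approx P :=
  ⟨P, .refl P, h, (IsPrefix.refl P).upToSwap⟩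

theorem Approx.upToSwap {R P : GRProcess N} (h : R.Approx P) : R.PrefixUpToSwap P := by
  obtain ⟨P', h1, -, h2⟩ := h
  exact h2.trans h1.upToSwap

theorem Approx.trans {R Q P : GRProcess N} (h : R.Approx Q) (h' : Q.Approx P) : R.Approx P :=
  .of_upToSwap h.upToSwap h'

end GRProcess

open GRProcess

theorem restrictLab_congr {l₁ l₂ : ℕ → Option N.T} {n : ℕ} (h : ∀ k, k < n → l₁ k = l₂ k) :
    restrictLab l₁ (Set.Iio n) = restrictLab l₂ (Set.Iio n) := by
  funext k
  by_cases hk : k < n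
  · rw [restrictLab_of_mem (X := Set.Iio n) hk, restrictLab_of_mem (X := Set.Iio n) hk, h k hk]
  · rw [restrictLab_of_not_mem (X := Set.Iio n) hk, restrictLab_of_not_mem (X := Set.Iio n) hk]

/-- An event whose products are not consumed does not precede any other event. -/
theorem IsRun.not_fplus {lab : ℕ → Option N.T} {con : Tok N → Option ℕ} (h : IsRun lab con)
    {b : ℕ} (hb : ∀ x k, con x = some k → x.1 ≠ some b) {t t' : (runNet h).net.T}
    (ht : t.down.1 = b) : ¬ (runNet h).net.FPlus (.inr t) (.inr t') := by
  intro hf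
  obtain ⟨y, hy, hyt⟩ := TransGen.head'_iff.1 hf
  rcases y with y | y
  · have h1 := (runNet_outArc_pos h).1 hy
    rcases ReflTransGen.cases_head_iff.1 hyt with h2 | ⟨z, hz, -⟩
    · cases h2
    · rcases z with z | z
      · exact absurd hz (lt_irrefl _)
      · exact hb _ _ ((runNet_inArc_pos h).1 hz) (by rw [h1, ht])
  · exact absurd hy (lt_irrefl _)

/-- An event whose products are not consumed can be postponed. -/
theorem IsRun.exists_postponed {lab : ℕ → Option N.T} {con : Tok N → Option ℕ} (h : IsRun lab con)
    {b i : ℕ} (hb : ∀ x k, con x = some k → x.1 ≠ some b) (hbi : b < i) (hi : lab i = none) :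
    ∃ (lab' : ℕ → Option N.T) (con' : Tok N → Option ℕ) (h' : IsRun lab' con'),
      (runProc h).1.Iso (runProc h').1 ∧ lab' b = none ∧ lab' i = lab b ∧
      ∀ k, k ≠ b → k ≠ i → lab' k = lab k := by
  classical
  set r : (runProc h).1.net.T → ℕ := fun t => (t : (runNet h).net.T).down.1 with hr
  have hr_some : ∀ t, lab (r t) ≠ none := fun t =>
    Option.isSome_iff_ne_none.1 (t : (runNet h).net.T).down.2
  have hr_inj : ∀ t t', r t = r t' → t = t' := fun a b hab => ULift.ext _ _ (Subtype.ext hab)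
  have hri : ∀ t, r t ≠ i := fun t ht => hr_some t (by rw [ht, hi])
  have hr_label : ∀ t, lab (r t) = some ((runProc h).1.mapT t) := fun t =>
    (Option.some_get (t : (runNet h).net.T).down.2).symm
  have hr_surj : ∀ k, lab k ≠ none → ∃ t, r t = k := fun k hk =>
    ⟨(⟨⟨k, Option.isSome_iff_ne_none.2 hk⟩⟩ : (runNet h).net.T), rfl⟩
  obtain ⟨lab', con', h', hiso, h1, h2⟩ := (runProc h).exists_run_of_numbering
    (fun t => if r t = b then i else r t)
    (fun t t' htt' => by
      have h3 := hri t
      have h4 := hri t'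
      refine hr_inj t t' ?_
      dsimp only at htt'
      split_ifs at htt' <;> omega)
    (fun t t' htt' => by
      have h3 : r t < r t' := by
        have := runRank_lt h htt'
        simp only [runRank] at this
        simp only [hr]
        omega
      -- Moving `b` up to `i` could only break the order towards successors of `b`, and there are
      -- none.
      have h4 : r t ≠ b := fun ht => h.not_fplus hb ht htt'
      split_ifs <;> omega)
  refine ⟨lab', con', h', hiso, ?_, ?_, fun k hkb hki => ?_⟩
  · by_contra hne
    obtain ⟨t, ht⟩ := h2 b hne
    split_ifs at ht <;> omega
  · by_cases hl : lab b = none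
    · rw [hl]
      by_contra hne
      obtain ⟨t, ht⟩ := h2 i hne
      split_ifs at ht with h3
      · exact hr_some t (by rw [h3, hl])
      · exact hri t ht
    · obtain ⟨t, ht⟩ := hr_surj b hl
      have := h1 t
      rw [if_pos ht] at this
      rw [this, ← hr_label, ht]
  · by_cases hl : lab k = none
    · rw [hl]
      by_contra hne
      obtain ⟨t, ht⟩ := h2 k hne
      split_ifs at ht with h3
      · exact hki ht.symm
      · exact hr_some t (by rw [ht, hl])
    · obtain ⟨t, ht⟩ := hr_surj k hl
      have := h1 t
      rw [if_neg (by rw [ht]; exact hkb)] at this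
      rw [← ht, this, ← hr_label]

theorem IsRun.finite_trunc {lab : ℕ → Option N.T} {con : Tok N → Option ℕ} (h : IsRun lab con)
    (n : ℕ) : (runProc (h.trunc n)).IsFinite := (h.trunc n).isFinite (bounded_trunc _ _)

/-- If all events of a finite run but the last one belong to an approximation of `P`, then, up to
swapping, `P` can be extended so that the whole run does. -/
theorem exists_extension_approx [Countable N.S] (hN : N.BinaryConflictFree) {ρ : ℕ → Option N.T}
    {c : Tok N → Option ℕ} (hρ : IsRun ρ c) (k : ℕ) {P : GRProcess N}
    (hP : (runProc (hρ.trunc k)).Approx P) :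
    ∃ P' W : GRProcess N, P'.bd = P.bd ∧ P'.IsPrefix W ∧ (runProc (hρ.trunc (k + 1))).Approx W := by
  classical
  -- Up to swapping, `P` becomes a run `l` that begins with the first `k` labels of `ρ` and has
  -- number `k` free.
  obtain ⟨D, hRD, hDP⟩ := hP.exists_prefix
  obtain ⟨l, cl, hl, hiso, hlt, hlk⟩ := exists_run_extending (bounded_trunc ρ k) hRD
  have hlρ : ∀ j, j < k → l j = ρ j := fun j hj => by
    rw [hlt j hj, restrictLab_of_mem (X := Set.Iio k) hj]
  have hbd : (runProc hl).bd = P.bd := (bd_eq_of_iso hiso).symm.trans hDP.bd_eq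
  cases hv : ρ k with
  | none =>
    refine ⟨P, P, rfl, .refl P, .of_upToSwap (SwapStar.upToSwap ?_) hP⟩
    refine runProc_swapStar_of_bounded _ _ (funext fun j => ?_) (bounded_trunc ρ (k + 1))
    rcases lt_trichotomy j k with hj | rfl | hj
    · rw [restrictLab_of_mem (by simp; omega), restrictLab_of_mem (by simpa using hj)]
    · rw [restrictLab_of_mem (by simp), hv, restrictLab_of_not_mem (by simp)]
    · rw [restrictLab_of_not_mem (by simp; omega), restrictLab_of_not_mem (by simp; omega)]
  | some v =>
    have hen : ∀ s, N.inArc s v ≤ marking l ∅ k s := by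
      rw [marking_congr ∅ hlρ]
      exact hρ.firable k v hv
    -- If `v` occurs later in `l`, then `P` already contains the event up to swapping. Otherwise `P`
    -- has to be extended by it.
    by_cases hex : ∃ i, k ≤ i ∧ l i = some v
    · obtain ⟨hki, hli⟩ := Nat.find_spec hex
      have hmin := fun j (hj : j < Nat.find hex) => Nat.find_min hex hj
      set i := Nat.find hex
      have hki' : k < i := lt_of_le_of_ne hki (by rintro h; rw [← h, hlk] at hli; cases hli)
      have hti := hl.trunc i
      have htk : restrictLab l (Set.Iio i) k = none := by
        rw [restrictLab_of_mem (X := Set.Iio i) hki', hlk]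
      -- By minimality of `i`, the part of `l` before `i` has no `v` from `k` on, so `v` can be
      -- inserted there.
      have hfir := hti.firable.insert hN (k := k) htk (v := v) (by
        rw [marking_congr ∅ (l₂ := l) fun j hj =>
          restrictLab_of_mem (X := Set.Iio i) (hj.trans hki')]
        exact hen) (fun j hkj hj => by
        obtain ⟨h1, h2⟩ := restrictLab_eq_some.1 hj
        exact hmin j h2 ⟨hkj, h1⟩)
      obtain ⟨c₁, h₁, hc₁⟩ := hfir.exists_run
      obtain ⟨l₂, c₂, h₂, hiso₂, h3, h4, h5⟩ := h₁.exists_postponed (b := k) (i := i)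
        (fun x j hx hxk => hc₁ x j k hx hxk rfl) hki' (by
          rw [Function.update_of_ne hki'.ne', restrictLab_of_not_mem (by simp)])
      refine ⟨P, P, rfl, .refl P, ?_⟩
      have ha : (runProc (hρ.trunc (k + 1))).Approx (runProc h₁) := by
        refine runProc_approx_of_eq _ _ (k + 1) (restrictLab_congr fun j hj => ?_)
        rcases Nat.lt_succ_iff_lt_or_eq.1 hj with hj | rfl
        · rw [Function.update_of_ne hj.ne, restrictLab_of_mem (X := Set.Iio i) (hj.trans hki'),
            hlρ j hj]
        · rw [Function.update_self, hv]
      -- After postponement the inserted `v` stands at `i`, where `l` has it too, and `k` is free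
      -- again. The labelling is that of `l` up to and including `i`.
      have hb : (runProc h₂).Approx (runProc hl) := by
        refine runProc_approx_of_eq _ _ (i + 1) (funext fun j => ?_)
        by_cases hjk : j = k
        · rw [hjk, h3, restrictLab_of_mem (by simp; omega), hlk]
        by_cases hji : j = i
        · rw [hji, h4, Function.update_self, restrictLab_of_mem (by simp), hli]
        rw [h5 j hjk hji, Function.update_of_ne hjk]
        by_cases hlt : j < i
        · rw [restrictLab_of_mem (X := Set.Iio i) hlt, restrictLab_of_mem (by simp; omega)]
        · rw [restrictLab_of_not_mem (X := Set.Iio i) hlt,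
            restrictLab_of_not_mem (by simp; omega)]
      exact ((ha.mono (isPrefix_of_iso hiso₂)).trans hb).congr (hρ.finite_trunc _) hbd
    · push Not at hex
      -- The products of the inserted event are never consumed, so removing it leaves a prefix. That
      -- prefix has labelling `l` and hence the same class as `P`.
      obtain ⟨c₁, h₁, hc₁⟩ := (hl.firable.insert hN hlk hen hex).exists_run
      have h₂ := h₁.restrict (X := {k}ᶜ) fun x j i hx _ hi => hc₁ x j i hx hi
      refine ⟨runProc h₂, runProc h₁, Eq.trans (bd_runProc_congr h₂ hl (funext fun j => ?_)) hbd,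
        h₁.restrict_isPrefix h₂, ?_⟩
      · by_cases hj : j = k
        · rw [hj, restrictLab_of_not_mem (by simp), hlk]
        · rw [restrictLab_of_mem (by simpa using hj), Function.update_of_ne hj]
      · refine runProc_approx_of_eq _ _ (k + 1) (restrictLab_congr fun j hj => ?_)
        rcases Nat.lt_succ_iff_lt_or_eq.1 hj with hj | rfl
        · rw [Function.update_of_ne hj.ne, hlρ j hj]
        · rw [Function.update_self, hv]

theorem approx_trunc_zero [Countable N.S] {ρ : ℕ → Option N.T} {c : Tok N → Option ℕ}
    (hρ : IsRun ρ c) (P : GRProcess N) : (runProc (hρ.trunc 0)).Approx P := by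
  obtain ⟨l, cl, hl, hiso⟩ := P.exists_run
  exact (runProc_approx_of_eq (hρ.trunc 0) hl 0
    (restrictLab_congr fun k hk => absurd hk (Nat.not_lt_zero k))).mono
    (isPrefix_of_iso (iso_symm hiso))

/-- A finite process is approximated by a truncated run. -/
theorem upToSwap_trunc {R : GRProcess N} {ρ : ℕ → Option N.T} {c : Tok N → Option ℕ}
    {hρ : IsRun ρ c} (hiso : R.1.Iso (runProc hρ).1) {n : ℕ} (hn : Bounded ρ n) :
    R.PrefixUpToSwap (runProc (hρ.trunc n)) :=
  (isPrefix_of_iso hiso).upToSwap.trans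
    (runProc_swapStar_of_bounded _ _ (restrictLab_eq_self hn).symm hn).upToSwap

theorem exists_bounded {R : GRProcess N} (hR : R.IsFinite) {ρ : ℕ → Option N.T}
    {c : Tok N → Option ℕ} {hρ : IsRun ρ c} (hiso : R.1.Iso (runProc hρ).1) :
    ∃ n, Bounded ρ n :=
  hρ.bounded_of_isFinite (hR.of_isPrefix (isPrefix_of_iso (iso_symm hiso)))

/-- A maximal process has all finite processes as approximations. -/
theorem approx_of_isMax [Countable N.S] (hN : N.BinaryConflictFree) {P : GRProcess N}
    (hP : IsMax (BDProcess.mk P)) {R : GRProcess N} (hR : R.IsFinite) : R.Approx P := by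
  obtain ⟨ρ, c, hρ, hiso⟩ := R.exists_run
  obtain ⟨n, hn⟩ := exists_bounded hR hiso
  refine .of_upToSwap (upToSwap_trunc hiso hn) ?_
  clear hn
  induction n with
  | zero => exact approx_trunc_zero hρ P
  | succ n ih =>
    obtain ⟨P', W, h1, h2, h3⟩ := exists_extension_approx hN hρ n ih
    -- Maximality puts the extension `W` back into the class of `P`.
    have h4 := BDProcess.isMax_iff.1 hP P' (BDProcess.mk_eq_mk.2 h1) W h2
    exact h3.congr (hρ.finite_trunc _) ((BDProcess.mk_eq_mk.1 h4).symm.trans h1)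

theorem exists_finite_prefix_of_pair [Countable N.S] {D P Q : GRProcess N} (hP : P.IsPrefix D)
    (hPfin : P.IsFinite) (hQ : Q.IsPrefix D) (hQfin : Q.IsFinite) :
    ∃ E : GRProcess N, E.IsFinite ∧ P.IsPrefix E ∧ Q.IsPrefix E := by
  obtain ⟨lab, con, hr, hiso⟩ := D.exists_run
  obtain ⟨n₁, h₁⟩ := hr.exists_trunc (hP.trans (isPrefix_of_iso hiso)) hPfin
  obtain ⟨n₂, h₂⟩ := hr.exists_trunc (hQ.trans (isPrefix_of_iso hiso)) hQfin
  exact ⟨_, hr.finite_trunc (max n₁ n₂), h₁ _ (le_max_left _ _), h₂ _ (le_max_right _ _)⟩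

/-- Every finite process extends to a finite process approximated by a given finite process. -/
theorem exists_finite_extension [Countable N.S] (hN : N.BinaryConflictFree) {P R : GRProcess N}
    (hP : P.IsFinite) (hR : R.IsFinite) :
    ∃ Q : GRProcess N, Q.IsFinite ∧ P.IsPrefix Q ∧ R.Approx Q := by
  obtain ⟨ρ, c, hρ, hiso⟩ := R.exists_run
  obtain ⟨n, hn⟩ := exists_bounded hR hiso
  suffices h : ∃ Q : GRProcess N, Q.IsFinite ∧ P.IsPrefix Q ∧ (runProc (hρ.trunc n)).Approx Q by
    obtain ⟨Q, h1, h2, h3⟩ := h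
    exact ⟨Q, h1, h2, .of_upToSwap (upToSwap_trunc hiso hn) h3⟩
  clear hn
  induction n with
  | zero => exact ⟨P, hP, .refl P, approx_trunc_zero hρ P⟩
  | succ n ih =>
    obtain ⟨Q, hQ, hPQ, hRQ⟩ := ih
    obtain ⟨Q', W, h1, h2, h3⟩ := exists_extension_approx hN hρ n hRQ
    -- The extension `W` need not be finite nor contain `Q` literally. Some `D` related to `W` by
    -- swaps contains `Q`, and a finite prefix `F` of `D` contains both `Q` and a witness `E` for
    -- the longer run.
    have h4 : Q.Approx W := ((Approx.refl hQ).congr hQ h1.symm).mono h2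
    obtain ⟨D, hQD, hDW⟩ := h4.exists_prefix
    obtain ⟨E, hED, hE, hRE⟩ := h3.congr (hρ.finite_trunc _) hDW.bd_eq.symm
    obtain ⟨F, hF, hQF, hEF⟩ := exists_finite_prefix_of_pair hQD hQ hED hE
    exact ⟨F, hF, hPQ.trans hQF, .of_upToSwap hRE ⟨E, hEF, hE, (IsPrefix.refl E).upToSwap⟩⟩

/-! ### The largest process -/

/-- The labelling given by a list. -/
def listLab (L : List (Option N.T)) (k : ℕ) : Option N.T := (L[k]?).join

theorem exists_listLab {lab : ℕ → Option N.T} {n : ℕ} (h : Bounded lab n) :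
    ∃ L, listLab L = lab := by
  refine ⟨(List.range n).map lab, funext fun k => ?_⟩
  unfold listLab
  by_cases hk : k < n
  · simp [hk]
  · simp [hk, h k (by omega)]

theorem bounded_listLab (L : List (Option N.T)) : Bounded (listLab L) L.length := by
  intro k hk
  simp [listLab, hk]

/-- A finite run extends to a finite run approximated by a given finite run. -/
theorem IsRun.exists_finite_extension [Countable N.S] (hN : N.BinaryConflictFree)
    {σ ρ : ℕ → Option N.T} {cσ cρ : Tok N → Option ℕ} (hσ : IsRun σ cσ) (hρ : IsRun ρ cρ) {n m : ℕ}
    (hn : Bounded σ n) (hm : Bounded ρ m) :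
    ∃ (τ : ℕ → Option N.T) (cτ : Tok N → Option ℕ) (hτ : IsRun τ cτ) (n' : ℕ), n < n' ∧
      Bounded τ n' ∧ (∀ k, k < n → τ k = σ k) ∧ (runProc hρ).Approx (runProc hτ) := by
  obtain ⟨Q, hQ, hσQ, hρQ⟩ := PetriNet.exists_finite_extension hN (hσ.isFinite hn) (hρ.isFinite hm)
  obtain ⟨τ, cτ, hτ, hiso, h1, -⟩ := exists_run_extending hn hσQ
  obtain ⟨n', hn'⟩ := exists_bounded hQ hiso
  exact ⟨τ, cτ, hτ, max n' (n + 1), by omega, hn'.mono (le_max_left _ _), h1,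
    hρQ.mono (isPrefix_of_iso hiso)⟩

/-- There is a process that has all finite processes as approximations. -/
theorem exists_largest [Countable N.S] [Countable N.T] (hN : N.BinaryConflictFree) :
    ∃ P : GRProcess N, ∀ R : GRProcess N, R.IsFinite → R.Approx P := by
  -- Stages record labelling and length only. The consumption functions may change from one stage to
  -- the next, which is harmless as they do not matter up to swapping.
  let Stage := {p : (ℕ → Option N.T) × ℕ // ∃ con, IsRun p.1 con ∧ Bounded p.1 p.2}
  have hstep : ∀ (st : Stage) (L : List (Option N.T)), ∃ st' : Stage, st.1.2 < st'.1.2 ∧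
      (∀ k, k < st.1.2 → st'.1.1 k = st.1.1 k) ∧
      ∀ c (h : IsRun (listLab L) c), ∃ c' , ∃ h' : IsRun st'.1.1 c',
        (runProc h).Approx (runProc h') := by
    rintro ⟨⟨σ, n⟩, cσ, hσ, hn⟩ L
    by_cases hL : ∃ c, IsRun (listLab L) c
    · obtain ⟨c, h⟩ := hL
      obtain ⟨τ, cτ, hτ, n', h1, h2, h3, h4⟩ :=
        hσ.exists_finite_extension hN h hn (bounded_listLab L)
      refine ⟨⟨⟨τ, n'⟩, cτ, hτ, h2⟩, h1, h3, fun c' hc' => ⟨cτ, hτ, ?_⟩⟩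
      exact .of_upToSwap
        (runProc_swapStar_of_bounded hc' h rfl (bounded_listLab L)).upToSwap h4
    -- A list that carries no run demands nothing, but the length still grows, so that the lengths
    -- tend to infinity.
    · exact ⟨⟨⟨σ, n + 1⟩, cσ, hσ, hn.mono (Nat.le_succ n)⟩, Nat.lt_succ_self n, fun _ _ => rfl,
        fun c h => absurd ⟨c, h⟩ hL⟩
  choose step hlt hagree happrox using hstep
  obtain ⟨enum, henum⟩ := exists_surjective_nat (List (Option N.T))
  have hzero : Firable (fun _ => none : ℕ → Option N.T) ∅ := fun k t ht => by cases ht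
  obtain ⟨c₀, hc₀, -⟩ := hzero.exists_run
  let st : ℕ → Stage := fun n => Nat.rec ⟨⟨fun _ => none, 0⟩, c₀, hc₀, fun _ _ => rfl⟩
    (fun n s => step s (enum n)) n
  have hst : ∀ n, st (n + 1) = step (st n) (enum n) := fun _ => rfl
  have hge : ∀ n, n ≤ (st n).1.2 := by
    intro n
    induction n with
    | zero => exact Nat.zero_le _
    | succ n ih =>
      have := hlt (st n) (enum n)
      rw [hst]
      omega
  have hmono : ∀ i j, i ≤ j → (st i).1.2 ≤ (st j).1.2 ∧
      ∀ k, k < (st i).1.2 → (st j).1.1 k = (st i).1.1 k := by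
    intro i j hij
    induction j, hij using Nat.le_induction with
    | base => exact ⟨le_rfl, fun _ _ => rfl⟩
    | succ j _ ih =>
      rw [hst]
      exact ⟨ih.1.trans (hlt _ _).le, fun k hk =>
        (hagree (st j) (enum j) k (hk.trans_le ih.1)).trans (ih.2 k hk)⟩
  -- Stage `k + 1` has length greater than `k`, so its label at `k` is final.
  let lab : ℕ → Option N.T := fun k => (st (k + 1)).1.1 k
  have hlab : ∀ n k, k < (st n).1.2 → lab k = (st n).1.1 k := by
    intro n k hk
    rcases le_total n (k + 1) with h | h
    · exact (hmono n (k + 1) h).2 k hk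
    · exact ((hmono (k + 1) n h).2 k (hge (k + 1))).symm
  -- Firability of event `k` involves only the labels up to `k`, which agree with those of one
  -- stage.
  have hfir : Firable lab ∅ := by
    intro k t hk s
    obtain ⟨c, hc, -⟩ := (st (k + 1)).2
    have h1 : ∀ j, j < k + 1 → lab j = (st (k + 1)).1.1 j := fun j hj =>
      hlab (k + 1) j (hj.trans_le (hge (k + 1)))
    rw [marking_congr ∅ (l₂ := (st (k + 1)).1.1) fun j hj => h1 j (by omega)]
    exact hc.firable k t hk s
  obtain ⟨c, hc, -⟩ := hfir.exists_run
  refine ⟨runProc hc, fun R hR => ?_⟩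
  obtain ⟨ρ, cρ, hρ, hiso⟩ := R.exists_run
  obtain ⟨n, hn⟩ := exists_bounded hR hiso
  obtain ⟨L, rfl⟩ := exists_listLab hn
  obtain ⟨j, rfl⟩ := henum L
  obtain ⟨c', h', happ⟩ := happrox (st j) (enum j) cρ hρ
  refine .of_upToSwap (isPrefix_of_iso hiso).upToSwap (happ.trans ?_)
  refine runProc_approx_of_eq h' hc (st (j + 1)).1.2 ?_
  obtain ⟨-, -, hbdd⟩ := (st (j + 1)).2
  rw [restrictLab_congr (hlab (j + 1)), restrictLab_eq_self hbdd]

/-- A countable binary-conflict-free net has exactly one maximal BD-process. -/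
theorem existsUnique_isMax [Countable N.S] [Countable N.T] (hN : N.BinaryConflictFree) :
    ∃! B : BDProcess N, IsMax B := by
  obtain ⟨P, hP⟩ := exists_largest hN
  refine ⟨BDProcess.mk P, ?_, fun B hB => ?_⟩
  · refine BDProcess.isMax_iff.2 fun P' hP' Q hQ => ?_
    rw [hP', BDProcess.mk_eq_mk]
    -- No extension can gain approximations, since `P` already has all of them.
    refine subset_antisymm ?_ (bd_subset_iff.2 fun R hR _ => hP R hR)
    exact (BDProcess.mk_eq_mk.1 hP').superset.trans (bd_mono hQ)
  · obtain ⟨Q, rfl⟩ := Quotient.exists_rep B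
    refine BDProcess.mk_eq_mk.2 (subset_antisymm ?_ ?_)
    · exact bd_subset_iff.2 fun R hR _ => hP R hR
    · exact bd_subset_iff.2 fun R hR _ => approx_of_isMax hN hB hR

end PetriNet

theorem mainTheorem3 (N : PetriNet.Net.{u}) [Countable N.S] [Countable N.T]
    (hN : N.BinaryConflictFree) :
    ∃! B : PetriNet.BDProcess N, IsMax B :=
  PetriNet.existsUnique_isMax hN
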